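/- Let $P$ be a stochastic matrix of M/G/1 type, $$P=\begin{pmatrix}B_1&B_2&B_3&B_4&\cdots\\ B_0&A_1&A_2&A_3&\cdots\\ &A_0&A_1&A_2&\cdots\\ &&A_0&A_1&\cdots\\ &&&\ddots&\ddots\end{pmatrix},$$ where $B_1$ is $m_0\times m_0$, the $A_k$ are $m\times m$, $B_0$ is $m\times m_0$ and $B_k$ is $m_0\times m$ for $k\ge 2$. Assume that the Markov chain $P$ is irreducible and positive recurrent, let $x=(x_0,x_1,x_2,\dots)$ be its stationary probability vector, partitioned by levels, and put $\pi_k=\sum_{j\ge k}x_j$ for $k\ge 1$ and $\pi=(\pi_1,\pi_2,\dots)$. Let $G$ be the minimal nonnegative solution of $G=\sum_{k\ge0}A_kG^k$ and put $$\Psi=\sum_{k\ge1}A_kG^{k-1},\qquad R_{0,j}=\Big(\sum_{k\ge j+1}B_kG^{k-j-1}\Big)(I-\Psi)^{-1},\qquad R_j=\Big(\sum_{k\ge j+1}A_kG^{k-j-1}\Big)(I-\Psi)^{-1}\qquad(j\ge1),$$ and $R_j=0$ for $j\le 0$. Then $I-\Psi$ is invertible, all the series here and below converge, and: (a) for every $k\ge1$,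 $$\pi_k=x_0\sum_{j\ge k}R_{0,j}+\sum_{i\ge1}x_i\sum_{j\ge k}R_{j-i}.$$ (b) Let $\bar A_k=\sum_{j\ge k}A_j$, let $$\mathbf P=\begin{pmatrix}\bar A_1&\bar A_2&\bar A_3&\cdots\\ A_0&A_1&A_2&\cdots\\ &A_0&A_1&\cdots\\ &&\ddots&\ddots\end{pmatrix},\qquad G_1=(I-\Psi)^{-1}A_0,\qquad \widehat\Psi_0=\bar A_1+\sum_{k\ge2}\bar A_kG^{k-2}G_1,$$ $$\widehat R_{0,j}=\Big(\sum_{k\ge j+1}\bar A_kG^{k-j-1}\Big)(I-\Psi)^{-1}\quad(j\ge1),$$ let $\Psi_D=\mathrm{diag}(\widehat\Psi_0,\Psi,\Psi,\dots)$, let $G_L$ be the block matrix whose only nonzero blocks are $G_1,G,G,\dots$ just below the diagonal, and let $R_U$ be the strictly upper triangular block matrix with first row $(0,\widehat R_{0,1},\widehat R_{0,2},\dots)$ and with block $R_{j-i}$ in position $(i,j)$ for $2\le i<j$. For each $T\in\{\mathbf P,G_L,\Psi_D,R_U\}$ the series $(I-T)^{-1}:=\sum_{n\ge0}T^n$ converges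 entrywise and is a two-sided inverse of $I-T$, and $$\pi=\Big(x_0\sum_{j\ge2}B_j,\;x_0\sum_{j\ge3}B_j,\dots\Big)(I-\mathbf P)^{-1}=\Big(x_0\sum_{j\ge2}B_j,\;x_0\sum_{j\ge3}B_j,\dots\Big)(I-G_L)^{-1}(I-\Psi_D)^{-1}(I-R_U)^{-1}.$$ -/

import Mathlib

open scoped Matrix

noncomputable section

namespace MG1

section Chain

variable {S : Type*}

/-- `P` is a (row-)stochastic matrix on the countable state space `S`. -/
def IsStochastic (P : Matrix S S ℝ) : Prop :=
  (∀ i j, 0 ≤ P i j) ∧ ∀ i, HasSum (fun j => P i j) 1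

/-- `firstPassage P j n i` is the probability that the chain started in `i` visits `j` at step
`n + 1` and at none of the steps `1, …, n`. -/
def firstPassage [DecidableEq S] (P : Matrix S S ℝ) (j : S) : ℕ → S → ℝ
  | 0, i => P i j
  | n + 1, i => ∑' k, if k = j then 0 else P i k * firstPassage P j n k

/-- Every state is positive recurrent: the return to it is certain and the mean return time
is finite. -/
def IsPositiveRecurrent [DecidableEq S] (P : Matrix S S ℝ) : Prop :=
  ∀ i, HasSum (fun n => firstPassage P i n i) 1 ∧
    Summable (fun n : ℕ => ((n : ℝ) + 1) * firstPassage P i n i)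

/-- `x` is a stationary probability vector of `P`. -/
def IsStationary (P : Matrix S S ℝ) (x : S → ℝ) : Prop :=
  (∀ i, 0 ≤ x i) ∧ HasSum x 1 ∧ ∀ j, HasSum (fun i => x i * P i j) (x j)

end Chain

section Infinite

variable {m : ℕ}

/-- An infinite matrix, with rows and columns indexed by `ℕ`, of `m × m` blocks. -/
abbrev BlockMatrix (m : ℕ) : Type := Matrix ℕ ℕ (Matrix (Fin m) (Fin m) ℝ)

/-- The powers `Tⁿ` of an infinite block matrix. -/
def blockPow (T : BlockMatrix m) : ℕ → BlockMatrix m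
  | 0 => 1
  | n + 1 => fun i k => ∑' j, blockPow T n i j * T j k

/-- The minimal inverse `(I - T)⁻¹ = ∑ₙ Tⁿ` (entrywise sums) for a nonnegative `T`. -/
def minInv (T : BlockMatrix m) : BlockMatrix m := fun i k => ∑' n, blockPow T n i k

/-- The series `∑ₙ Tⁿ` converges entrywise, and its sum is a two-sided inverse of `I - T`
(all the infinite sums in the two matrix products being convergent). -/
def HasMinInv (T : BlockMatrix m) : Prop :=
  (∀ i k, Summable (fun n => blockPow T n i k)) ∧
  (∀ i k, HasSum (fun j => (1 - T) i j * minInv T j k) ((1 : BlockMatrix m) i k)) ∧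
  (∀ i k, HasSum (fun j => minInv T i j * (1 - T) j k) ((1 : BlockMatrix m) i k))

/-- `w = v M` for infinite block row vectors `v`, `w`, all the sums being convergent. -/
def IsVecMul (v : ℕ → Fin m → ℝ) (M : BlockMatrix m) (w : ℕ → Fin m → ℝ) : Prop :=
  ∀ k, HasSum (fun i => v i ᵥ* M i k) (w k)

end Infinite

/-- The blocks of a transition matrix of M/G/1 type
```
B₁ B₂ B₃ B₄ …
B₀ A₁ A₂ A₃ …
   A₀ A₁ A₂ …
      A₀ A₁ …
```
`B k` is the block `B_k` for `k ≥ 2`; the values `B 0` and `B 1` are never used. -/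
structure Blocks (m₀ m : ℕ) where
  B₀ : Matrix (Fin m) (Fin m₀) ℝ
  B₁ : Matrix (Fin m₀) (Fin m₀) ℝ
  B : ℕ → Matrix (Fin m₀) (Fin m) ℝ
  A : ℕ → Matrix (Fin m) (Fin m) ℝ

/-- The states: `Sum.inl a` is phase `a` of level `0`, and `Sum.inr (n, a)` is phase `a` of
level `n + 1`. -/
abbrev State (m₀ m : ℕ) : Type := Fin m₀ ⊕ (ℕ × Fin m)

/-- The part of a vector on the states that belongs to level `0`. -/
def levelZero {m₀ m : ℕ} (x : State m₀ m → ℝ) : Fin m₀ → ℝ := fun a => x (Sum.inl a)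

/-- The part of a vector on the states that belongs to level `n + 1`. -/
def levelSucc {m₀ m : ℕ} (x : State m₀ m → ℝ) (n : ℕ) : Fin m → ℝ := fun a => x (Sum.inr (n, a))

/-- The tail `π_{k+1} = ∑_{j ≥ k+1} x_j`. -/
def tail {m₀ m : ℕ} (x : State m₀ m → ℝ) (k : ℕ) : Fin m → ℝ := ∑' j, levelSucc x (k + j)

namespace Blocks

variable {m₀ m : ℕ} (D : Blocks m₀ m)

/-- The transition matrix of M/G/1 type with the given blocks. -/
def transition : Matrix (State m₀ m) (State m₀ m) ℝ
  | Sum.inl a, Sum.inl b => D.B₁ a b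
  | Sum.inl a, Sum.inr (n, b) => D.B (n + 2) a b
  | Sum.inr (0, a), Sum.inl b => D.B₀ a b
  | Sum.inr (_ + 1, _), Sum.inl _ => 0
  | Sum.inr (i, a), Sum.inr (j, b) => if i ≤ j + 1 then D.A (j + 1 - i) a b else 0

/-- `G` is the (entrywise) minimal nonnegative solution of `G = ∑_{k ≥ 0} A_k Gᵏ`. -/
def IsMinimalSolution (G : Matrix (Fin m) (Fin m) ℝ) : Prop :=
  (∀ a b, 0 ≤ G a b) ∧ HasSum (fun k => D.A k * G ^ k) G ∧
  ∀ H : Matrix (Fin m) (Fin m) ℝ, (∀ a b, 0 ≤ H a b) → HasSum (fun k => D.A k * H ^ k) H →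
    ∀ a b, G a b ≤ H a b

variable (G : Matrix (Fin m) (Fin m) ℝ)

/-- `Ψ = ∑_{k ≥ 1} A_k G^{k-1}`. -/
def Psi : Matrix (Fin m) (Fin m) ℝ := ∑' k, D.A (k + 1) * G ^ k

/-- `R_{0,j} = (∑_{k ≥ j+1} B_k G^{k-j-1}) (I - Ψ)⁻¹`, for `j ≥ 1`. -/
def R0 (j : ℕ) : Matrix (Fin m₀) (Fin m) ℝ :=
  (∑' k, D.B (j + 1 + k) * G ^ k) * (1 - D.Psi G)⁻¹

/-- `R_j = (∑_{k ≥ j+1} A_k G^{k-j-1}) (I - Ψ)⁻¹`, for `j ≥ 1`. -/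
def R (j : ℕ) : Matrix (Fin m) (Fin m) ℝ :=
  (∑' k, D.A (j + 1 + k) * G ^ k) * (1 - D.Psi G)⁻¹

/-- `R_{j-i}`, with the convention that it is `0` for `j ≤ i`. -/
def RDiff (i j : ℕ) : Matrix (Fin m) (Fin m) ℝ := if i < j then D.R G (j - i) else 0

/-- `Ā_k = ∑_{j ≥ k} A_j`. -/
def ATail (k : ℕ) : Matrix (Fin m) (Fin m) ℝ := ∑' j, D.A (k + j)

/-- The matrix **P** of the equation `π = π **P** + b` for the tails: its first row of blocks
is `Ā₁, Ā₂, …`, and the following rows are those of a matrix of M/G/1 type.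
Row and column `n` belong to level `n + 1`. -/
def tailMatrix : BlockMatrix m := fun i j =>
  if i = 0 then D.ATail (j + 1) else if i ≤ j + 1 then D.A (j + 1 - i) else 0

/-- `G₁ = (I - Ψ)⁻¹ A₀`, the boundary entry of the `G`-measure of **P**. -/
def G1 : Matrix (Fin m) (Fin m) ℝ := (1 - D.Psi G)⁻¹ * D.A 0

/-- `Ψ̂₀ = Ā₁ + ∑_{k ≥ 2} Ā_k G^{k-2} G₁`. -/
def PsiHat0 : Matrix (Fin m) (Fin m) ℝ :=
  D.ATail 1 + ∑' k, D.ATail (k + 2) * G ^ k * D.G1 G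

/-- The first row of the `R`-measure of **P**:
`R̂_{0,j} = (∑_{k ≥ j+1} Ā_k G^{k-j-1}) (I - Ψ)⁻¹`, for `j ≥ 1`. -/
def RHat0 (j : ℕ) : Matrix (Fin m) (Fin m) ℝ :=
  (∑' k, D.ATail (j + 1 + k) * G ^ k) * (1 - D.Psi G)⁻¹

/-- `R_U`: first row `0, R̂_{0,1}, R̂_{0,2}, …`, and `R_{j-i}` strictly above the diagonal in the
other rows. -/
def RU : BlockMatrix m := fun i j =>
  if i < j then (if i = 0 then D.RHat0 G j else D.R G (j - i)) else 0

/-- `Ψ_D = diag (Ψ̂₀, Ψ, Ψ, …)`. -/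
def PsiD : BlockMatrix m := Matrix.diagonal fun i => if i = 0 then D.PsiHat0 G else D.Psi G

/-- `G_L`: the entries just below the diagonal are `G₁, G, G, …`, all others are `0`. -/
def lowerG : BlockMatrix m := fun i j =>
  if i = j + 1 then (if j = 0 then D.G1 G else G) else 0

/-- The block row vector `(x₀ ∑_{j ≥ 2} B_j, x₀ ∑_{j ≥ 3} B_j, …)`. -/
def boundary (x : State m₀ m → ℝ) (i : ℕ) : Fin m → ℝ :=
  levelZero x ᵥ* ∑' j, D.B (i + 2 + j)

end Blocks

end MG1

end

/-!
On and above the subdiagonal, the matrices `T` in question have constant diagonals in all rows but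
the first. Put `W_{i,k} = ∑ₗ T_{i,k+l} Gˡ`; this folds every excursion above level `k` into one
step, and `W_{i,k} = T_{i,k} + W_{i,k+1} G`. If `y = β + y T`, the vectors
`u_k = y_k - ∑_{i ≤ k} y_i W_{i,k}` therefore satisfy `u = β + u G_L`, and going from `u` back to
`y` amounts to applying `(I - Ψ_D)⁻¹` and `(I - R_U)⁻¹`. For the chain killed at level `0`, where
`W_{k,k} = Ψ` and `y = (x₁, x₂, …)`, this is Ramaswami's recursion for the stationary vector, which
sums to (a). Since `π = b + π P` with `b` the boundary vector, applying it to the matrix `P` of the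
tails gives the factorization in (b).

All convergence rests on the minimal inverse `N` of `I - P`. The vector `π Pⁿ` consists of the
tails of `x Kⁿ`, where `K` is the killed chain, and it tends to `0` because an irreducible chain
that is killed at level `0` has no nonzero summable invariant vector; hence `b (I + P + ⋯ + Pⁿ)`
increases to `π`. The columns of `N` are superharmonic, so `Gˡ N_{j,k} ≤ N_{j+l,k}`, which bounds
the series `W_{i,k}`.
-/

noncomputable section

namespace MG1

open Filter Topology

/-! ### Sums in ordered groups -/

section OrderedGroup

theorem sum_col_le_of_nonneg {ι κ E : Type*} [AddCommMonoid E] [PartialOrder E]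
    [IsOrderedAddMonoid E] [TopologicalSpace E] [OrderClosedTopology E] [ContinuousAdd E]
    {f : ι → κ → E} {r : ι → E} {c : κ → E} {s : E} (hf : ∀ i j, 0 ≤ f i j)
    (hrow : ∀ i, HasSum (f i) (r i)) (hcol : ∀ j, HasSum (fun i => f i j) (c j)) (hr : HasSum r s)
    (t : Finset κ) : ∑ j ∈ t, c j ≤ s :=
  hasSum_le (fun i => sum_le_hasSum t (fun j _ => hf i j) (hrow i))
    (hasSum_sum fun j _ => hcol j) hr

variable {ι κ E : Type*} [AddCommGroup E] [ConditionallyCompleteLattice E] [IsOrderedAddMonoid E]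
  [TopologicalSpace E] [SupConvergenceClass E]

theorem summable_of_nonneg_of_sum_le {f : ι → E} {c : E} (hf : ∀ i, 0 ≤ f i)
    (hc : ∀ s : Finset ι, ∑ i ∈ s, f i ≤ c) : Summable f :=
  ⟨_, tendsto_atTop_ciSup (Finset.sum_mono_set_of_nonneg hf) ⟨c, Set.forall_mem_range.2 hc⟩⟩

theorem summable_of_nonneg_of_sum_range_le {f : ℕ → E} {c : E} (hf : ∀ i, 0 ≤ f i)
    (hc : ∀ n, ∑ i ∈ Finset.range n, f i ≤ c) : Summable f :=
  summable_of_nonneg_of_sum_le hf fun s =>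
    have ⟨n, hn⟩ := s.exists_nat_subset_range
    (Finset.sum_le_sum_of_subset_of_nonneg hn fun i _ _ => hf i).trans (hc n)

variable [OrderClosedTopology E]

theorem summable_of_nonneg_of_le {f g : ι → E} (hf : ∀ i, 0 ≤ f i) (hfg : ∀ i, f i ≤ g i)
    (hg : Summable g) : Summable f :=
  summable_of_nonneg_of_sum_le hf fun s =>
    (Finset.sum_le_sum fun i _ => hfg i).trans
      (sum_le_hasSum s (fun i _ => (hf i).trans (hfg i)) hg.hasSum)

theorem hasSum_comm_of_nonneg [ContinuousAdd E] {f : ι → κ → E} {r : ι → E} {c : κ → E} {s : E}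
    (hf : ∀ i j, 0 ≤ f i j) (hrow : ∀ i, HasSum (f i) (r i))
    (hcol : ∀ j, HasSum (fun i => f i j) (c j)) (hr : HasSum r s) : HasSum c s := by
  obtain ⟨s', hc⟩ : Summable c := summable_of_nonneg_of_sum_le
    (fun j => (hcol j).nonneg fun i => hf i j) (sum_col_le_of_nonneg hf hrow hcol hr)
  rwa [le_antisymm (hasSum_le_of_sum_le hr (sum_col_le_of_nonneg (fun j i => hf i j) hcol hrow hc))
    (hasSum_le_of_sum_le hc (sum_col_le_of_nonneg hf hrow hcol hr))]

theorem hasSum_of_nonneg_of_tendsto_sum_range {f : ℕ → E} {c : E} (hf : ∀ i, 0 ≤ f i)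
    (hc : Tendsto (fun n => ∑ i ∈ Finset.range n, f i) atTop (𝓝 c)) : HasSum f c := by
  have hmono : Monotone fun n => ∑ i ∈ Finset.range n, f i :=
    (Finset.sum_mono_set_of_nonneg hf).comp Finset.range_mono
  have hsum := (summable_of_nonneg_of_sum_range_le hf (hmono.ge_of_tendsto hc)).hasSum
  rwa [tendsto_nhds_unique hsum.tendsto_sum_nat hc] at hsum

end OrderedGroup

theorem summable_pow_of_one_add_mul_le {R : Type*} [Ring R] [ConditionallyCompleteLattice R]
    [IsOrderedRing R] [TopologicalSpace R] [SupConvergenceClass R] {x y : R} (hx : 0 ≤ x)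
    (hy : 0 ≤ y) (h : 1 + x * y ≤ y) : Summable fun n : ℕ => x ^ n := by
  refine summable_of_nonneg_of_sum_range_le (c := y) (pow_nonneg hx) fun n => ?_
  induction n with
  | zero => simpa using hy
  | succ n ih =>
    calc ∑ i ∈ Finset.range (n + 1), x ^ i = 1 + x * ∑ i ∈ Finset.range n, x ^ i := by
          rw [geom_sum_succ, add_comm]
      _ ≤ 1 + x * y := by gcongr
      _ ≤ y := h

/-! ### Matrices ordered entrywise -/

section EntrywiseOrder

variable {p q r : Type*}

/-- The entrywise order on matrices (not the Loewner order of the scope `MatrixOrder`). -/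
scoped instance {E : Type*} [ConditionallyCompleteLattice E] :
    ConditionallyCompleteLattice (Matrix p q E) :=
  inferInstanceAs (ConditionallyCompleteLattice (p → q → E))

scoped instance {E : Type*} [AddCommMonoid E] [ConditionallyCompleteLattice E]
    [IsOrderedAddMonoid E] : IsOrderedAddMonoid (Matrix p q E) :=
  inferInstanceAs (IsOrderedAddMonoid (p → q → E))

scoped instance : OrderClosedTopology (Matrix p q ℝ) :=
  inferInstanceAs (OrderClosedTopology (p → q → ℝ))

scoped instance : SupConvergenceClass (Matrix p q ℝ) :=
  inferInstanceAs (SupConvergenceClass (p → q → ℝ))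

theorem matrix_mul_le_mul_left [Fintype q] {M : Matrix p q ℝ} {N N' : Matrix q r ℝ} (hM : 0 ≤ M)
    (hN : N ≤ N') : M * N ≤ M * N' := fun a b =>
  Finset.sum_le_sum fun c _ => mul_le_mul_of_nonneg_left (hN c b) (hM a c)

theorem matrix_mul_le_mul_right [Fintype q] {M M' : Matrix p q ℝ} {N : Matrix q r ℝ} (hM : M ≤ M')
    (hN : 0 ≤ N) : M * N ≤ M' * N := fun a b =>
  Finset.sum_le_sum fun c _ => mul_le_mul_of_nonneg_right (hM a c) (hN c b)

theorem matrix_mul_nonneg [Fintype q] {M : Matrix p q ℝ} {N : Matrix q r ℝ} (hM : 0 ≤ M)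
    (hN : 0 ≤ N) : 0 ≤ M * N := fun a b =>
  Finset.sum_nonneg fun c _ => mul_nonneg (hM a c) (hN c b)

theorem vecMul_nonneg [Fintype p] {v : p → ℝ} {M : Matrix p q ℝ} (hv : 0 ≤ v) (hM : 0 ≤ M) :
    0 ≤ v ᵥ* M := fun b =>
  Finset.sum_nonneg fun a _ => mul_nonneg (hv a) (hM a b)

theorem mul_le_vecMul [Fintype p] {v : p → ℝ} {M : Matrix p q ℝ} (hv : 0 ≤ v) (hM : 0 ≤ M) (a : p)
    (b : q) : v a * M a b ≤ (v ᵥ* M) b :=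
  Finset.single_le_sum (f := fun a => v a * M a b) (fun a _ => mul_nonneg (hv a) (hM a b))
    (Finset.mem_univ a)

theorem matrix_one_nonneg {R : Type*} [Semiring R] [ConditionallyCompleteLattice R]
    [IsOrderedRing R] [DecidableEq p] : (0 : Matrix p p R) ≤ 1 := fun a b => by
  rw [Matrix.one_apply]
  split_ifs
  exacts [zero_le_one, le_rfl]

scoped instance [Fintype p] [DecidableEq p] : IsOrderedRing (Matrix p p ℝ) where
  zero_le_one := matrix_one_nonneg
  mul_le_mul_of_nonneg_left _ hM _ _ hN := matrix_mul_le_mul_left hM hN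
  mul_le_mul_of_nonneg_right _ hN _ _ hM := matrix_mul_le_mul_right hM hN

theorem matrix_summable_iff {X : Type*} {f : X → Matrix p q ℝ} :
    Summable f ↔ ∀ a b, Summable fun i => f i a b :=
  Pi.summable.trans <| forall_congr' fun _ => Pi.summable

theorem hasSum_matrix_mul_left [Fintype q] {X : Type*} {f : X → Matrix q r ℝ} {M : Matrix q r ℝ}
    (N : Matrix p q ℝ) (hf : HasSum f M) : HasSum (fun i => N * f i) (N * M) :=
  hf.map (AddMonoidHom.mk' (N * ·) (Matrix.mul_add N)) (continuous_const.matrix_mul continuous_id)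

theorem hasSum_matrix_mul_right [Fintype q] {X : Type*} {f : X → Matrix p q ℝ} {M : Matrix p q ℝ}
    (N : Matrix q r ℝ) (hf : HasSum f M) : HasSum (fun i => f i * N) (M * N) :=
  hf.map (AddMonoidHom.mk' (· * N) fun M M' => Matrix.add_mul M M' N)
    (continuous_id.matrix_mul continuous_const)

theorem hasSum_vecMul_left [Fintype p] {X : Type*} {f : X → Matrix p q ℝ} {M : Matrix p q ℝ}
    (v : p → ℝ) (hf : HasSum f M) : HasSum (fun i => v ᵥ* f i) (v ᵥ* M) :=
  hf.map (AddMonoidHom.mk' (v ᵥ* ·) fun M M' => Matrix.vecMul_add M M' v)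
    (continuous_const.matrix_vecMul continuous_id)

theorem hasSum_vecMul_right [Fintype p] {X : Type*} {f : X → p → ℝ} {v : p → ℝ}
    (M : Matrix p q ℝ) (hf : HasSum f v) : HasSum (fun i => f i ᵥ* M) (v ᵥ* M) :=
  hf.map (AddMonoidHom.mk' (· ᵥ* M) (Matrix.add_vecMul M))
    (continuous_id.matrix_vecMul continuous_const)

theorem hasSum_pow_inv_one_sub [Fintype p] [DecidableEq p] {M : Matrix p p ℝ}
    (h : Summable fun n => M ^ n) : HasSum (fun n => M ^ n) (1 - M)⁻¹ :=
  Matrix.inv_eq_right_inv h.one_sub_mul_tsum_pow ▸ h.hasSum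

theorem isUnit_one_sub_of_summable_pow {R : Type*} [Ring R] [TopologicalSpace R]
    [IsTopologicalRing R] [T2Space R] {x : R} (h : Summable fun n : ℕ => x ^ n) :
    IsUnit (1 - x) :=
  ⟨⟨1 - x, ∑' n, x ^ n, h.one_sub_mul_tsum_pow, h.tsum_pow_mul_one_sub⟩, rfl⟩

theorem tendsto_sum_range_mul_sub {R : Type*} [NormedRing R] [CompleteSpace R] {f g : ℕ → R}
    (hf : Tendsto f atTop (𝓝 0)) (hg : Summable fun n => ‖g n‖) :
    Tendsto (fun k => ∑ i ∈ Finset.range (k + 1), f i * g (k - i)) atTop (𝓝 0) := by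
  obtain ⟨C, hC⟩ := (Metric.isBounded_range_of_tendsto f hf).exists_norm_le
  have hlim : ∀ j, Tendsto (fun k => if j ≤ k then f (k - j) * g j else 0) atTop (𝓝 0) :=
    fun j => by
      have h := (hf.comp (tendsto_sub_atTop_nat j)).mul_const (g j)
      rw [zero_mul] at h
      exact h.congr' <| (eventually_ge_atTop j).mono fun k hk => (if_pos hk).symm
  have hbound : ∀ k j, ‖if j ≤ k then f (k - j) * g j else 0‖ ≤ C * ‖g j‖ := fun k j => by
    split_ifs
    · exact (norm_mul_le _ _).trans (by gcongr; exact hC _ ⟨_, rfl⟩)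
    · simpa using mul_nonneg ((norm_nonneg _).trans (hC _ ⟨0, rfl⟩)) (norm_nonneg (g j))
  have key := tendsto_tsum_of_dominated_convergence (hg.mul_left C) hlim
    (Eventually.of_forall hbound)
  rw [tsum_zero] at key
  refine key.congr fun k => ?_
  rw [tsum_eq_sum (s := Finset.range (k + 1)) fun j hj => if_neg (by simpa using hj),
    ← Finset.sum_range_reflect]
  refine Finset.sum_congr rfl fun j hj => ?_
  have hjk : j ≤ k := Nat.lt_succ_iff.1 (Finset.mem_range.1 hj)
  rw [if_pos (by omega), Nat.add_sub_cancel, Nat.sub_sub_self hjk]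

theorem tendsto_sum_range_vecMul_sub [Fintype p] {f : ℕ → p → ℝ} {g : ℕ → Matrix p q ℝ}
    (hf : Tendsto f atTop (𝓝 0)) (hg : Summable g) :
    Tendsto (fun k => ∑ i ∈ Finset.range (k + 1), f i ᵥ* g (k - i)) atTop (𝓝 0) := by
  refine tendsto_pi_nhds.2 fun b => ?_
  have h := tendsto_finsetSum Finset.univ fun a _ =>
    tendsto_sum_range_mul_sub (tendsto_pi_nhds.1 hf a) (matrix_summable_iff.1 hg a b).norm
  simp only [Finset.sum_const_zero] at h
  refine h.congr fun k => ?_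
  rw [Finset.sum_comm, Finset.sum_apply]
  rfl

theorem hasSum_one_mul [DecidableEq p] {R : Type*} [Semiring R] [TopologicalSpace R]
    (M : Matrix p q R) (i : p) (k : q) :
    HasSum (fun j => (1 : Matrix p p R) i j * M j k) (M i k) := by
  convert hasSum_single i fun j hj => ?_
  · simp
  · rw [Matrix.one_apply_ne' hj, zero_mul]

theorem hasSum_mul_one [DecidableEq q] {R : Type*} [Semiring R] [TopologicalSpace R]
    (M : Matrix p q R) (i : p) (k : q) :
    HasSum (fun j => M i j * (1 : Matrix q q R) j k) (M i k) := by
  convert hasSum_single k fun j hj => ?_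
  · simp
  · rw [Matrix.one_apply_ne hj, mul_zero]

end EntrywiseOrder

section Chain

variable {S : Type*} {P : Matrix S S ℝ}

theorem forall_of_isIrreducible (hirr : P.IsIrreducible) (C : S → Prop)
    (hstep : ∀ i j, C i → 0 < P i j → C j) {i : S} (hi : C i) (j : S) : C j := by
  let _ : Quiver S := P.toQuiver
  obtain ⟨path, -⟩ := hirr.connected i j
  induction path with
  | nil => exact hi
  | cons _ e ih => exact hstep _ _ ih e.down

theorem pos_of_invariant (hP : ∀ i j, 0 ≤ P i j) (hirr : P.IsIrreducible) {w : S → ℝ}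
    (hw : ∀ i, 0 ≤ w i) (hinv : ∀ j, HasSum (fun i => w i * P i j) (w j)) {i : S} (hi : 0 < w i)
    (j : S) : 0 < w j :=
  forall_of_isIrreducible hirr (fun s => 0 < w s) (fun s t hs hst =>
    (mul_pos hs hst).trans_le <|
      le_hasSum (hinv t) s fun k _ => mul_nonneg (hw k) (hP k t)) hi j

theorem stationary_pos (hP : IsStochastic P) (hirr : P.IsIrreducible) {x : S → ℝ}
    (hx : IsStationary P x) (s : S) : 0 < x s := by
  obtain ⟨i, hi⟩ : ∃ i, 0 < x i := by
    by_contra! hnonpos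
    obtain rfl : x = 0 := le_antisymm hnonpos hx.1
    exact zero_ne_one (hasSum_zero.unique hx.2.1)
  exact pos_of_invariant hP.1 hirr hx.1 hx.2.2 hi s

theorem invariant_of_le (hP : IsStochastic P) {w w' : S → ℝ} (hw : ∀ i, 0 ≤ w i)
    (hws : Summable w) (hw' : ∀ j, HasSum (fun i => w i * P i j) (w' j)) (hle : ∀ j, w j ≤ w' j) :
    w' = w := by
  have hmass : HasSum w' (∑' i, w i) :=
    hasSum_comm_of_nonneg (fun i j => mul_nonneg (hw i) (hP.1 i j))
      (fun i => by simpa using (hP.2 i).mul_left (w i)) hw' hws.hasSum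
  have hdiff := hmass.sub hws.hasSum
  rw [sub_self, hasSum_zero_iff_of_nonneg fun j => sub_nonneg.2 (hle j)] at hdiff
  exact sub_eq_zero.1 hdiff

theorem eq_zero_of_le_of_apply_eq_zero (hP : IsStochastic P) (hirr : P.IsIrreducible)
    {w w' : S → ℝ} (hw : ∀ i, 0 ≤ w i) (hws : Summable w)
    (hw' : ∀ j, HasSum (fun i => w i * P i j) (w' j)) (hle : ∀ j, w j ≤ w' j) {s : S}
    (hs : w s = 0) : w = 0 := by
  obtain rfl := invariant_of_le hP hw hws hw' hle
  by_contra hne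
  obtain ⟨i, hi⟩ := Function.ne_iff.1 hne
  exact (pos_of_invariant hP.1 hirr hw hw' ((hw i).lt_of_ne' hi) s).ne' hs

end Chain

section BlockMatrix

variable {m : ℕ} {T : BlockMatrix m}

/-- `T` vanishes below its subdiagonal, as do all the block matrices of M/G/1 type. -/
def IsUpperHessenberg (T : BlockMatrix m) : Prop := ∀ ⦃i j⦄, j + 1 < i → T i j = 0

/-- The block row vector `w T`; the sum is finite because `T` is meant to be upper Hessenberg. -/
def vecStep (T : BlockMatrix m) : Module.End ℝ (ℕ → Fin m → ℝ) :=
  LinearMap.pi fun k => ∑ j ∈ Finset.range (k + 2), (T j k).vecMulLinear ∘ₗ LinearMap.proj j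

theorem vecStep_apply (T : BlockMatrix m) (w : ℕ → Fin m → ℝ) (k : ℕ) :
    vecStep T w k = ∑ j ∈ Finset.range (k + 2), w j ᵥ* T j k := by
  simp [vecStep]

theorem vecStep_pow_succ_apply (T : BlockMatrix m) (n : ℕ) (w : ℕ → Fin m → ℝ) :
    (vecStep T ^ (n + 1)) w = vecStep T ((vecStep T ^ n) w) := by
  rw [pow_succ', Module.End.mul_apply]

theorem eq_sum_pow_apply_add {R M : Type*} [Ring R] [AddCommGroup M] [Module R M]
    {L : Module.End R M} {b w : M} (h : w = b + L w) (n : ℕ) :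
    w = ∑ i ∈ Finset.range n, (L ^ i) b + (L ^ n) w := by
  have hb : b = (1 - L) w := eq_sub_of_add_eq h.symm
  have hgeom := congrArg (· w) (geom_sum_mul_neg L n)
  simp only [Module.End.mul_apply, ← hb, LinearMap.sum_apply, LinearMap.sub_apply,
    Module.End.one_apply] at hgeom
  rw [hgeom, sub_add_cancel]

theorem continuous_vecStep (T : BlockMatrix m) : Continuous (vecStep T) :=
  continuous_pi fun k => by
    simp only [vecStep_apply]
    exact continuous_finsetSum _ fun j _ => (continuous_apply j).matrix_vecMul continuous_const

theorem vecStep_nonneg (hT : 0 ≤ T) {w : ℕ → Fin m → ℝ} (hw : 0 ≤ w) : 0 ≤ vecStep T w :=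
  fun k => by
    rw [vecStep_apply]
    exact Finset.sum_nonneg fun j _ => vecMul_nonneg (hw j) (hT j k)

theorem vecStep_pow_nonneg (hT : 0 ≤ T) {w : ℕ → Fin m → ℝ} (hw : 0 ≤ w) (n : ℕ) :
    0 ≤ (vecStep T ^ n) w := by
  induction n with
  | zero => exact hw
  | succ n ih => exact vecStep_pow_succ_apply T n w ▸ vecStep_nonneg hT ih

theorem mul_le_vecStep (hT : 0 ≤ T) (hH : IsUpperHessenberg T) {w : ℕ → Fin m → ℝ} (hw : 0 ≤ w)
    (i k : ℕ) (a d : Fin m) : w i a * T i k a d ≤ vecStep T w k d := by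
  by_cases hik : k + 1 < i
  · simpa [hH hik] using vecStep_nonneg hT hw k d
  · rw [vecStep_apply]
    exact (mul_le_vecMul (hw i) (hT i k) a d).trans <|
      Finset.single_le_sum (f := fun j => w j ᵥ* T j k)
        (fun j _ => vecMul_nonneg (hw j) (hT j k)) (Finset.mem_range.2 (by omega)) d

theorem isVecMul_vecStep (hH : IsUpperHessenberg T) (w : ℕ → Fin m → ℝ) :
    IsVecMul w T (vecStep T w) := fun k => by
  rw [vecStep_apply]
  refine hasSum_sum_of_ne_finset_zero fun j hj => ?_
  rw [hH (by rw [Finset.mem_range] at hj; omega), Matrix.vecMul_zero]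

theorem blockPow_nonneg (hT : 0 ≤ T) (n : ℕ) : 0 ≤ blockPow T n := by
  induction n with
  | zero => exact matrix_one_nonneg
  | succ n ih => exact fun i k => tsum_nonneg fun j => matrix_mul_nonneg (ih i j) (hT j k)

theorem minInv_nonneg (hT : 0 ≤ T) : 0 ≤ minInv T := fun i k =>
  tsum_nonneg fun n => blockPow_nonneg hT n i k

theorem blockPow_succ (hH : IsUpperHessenberg T) (n i k : ℕ) :
    blockPow T (n + 1) i k = ∑ j ∈ Finset.range (k + 2), blockPow T n i j * T j k :=
  tsum_eq_sum fun j hj => by rw [hH (by rw [Finset.mem_range] at hj; omega), mul_zero]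

theorem hasSum_mul_blockPow (hH : IsUpperHessenberg T) (n i k : ℕ) :
    HasSum (fun j => T i j * blockPow T n j k) (blockPow T (n + 1) i k) := by
  induction n generalizing k with
  | zero =>
    rw [show blockPow T 1 i k = T i k from (hasSum_one_mul T i k).tsum_eq]
    exact hasSum_mul_one T i k
  | succ n ih =>
    simp only [blockPow_succ hH (n + 1), blockPow_succ hH n _ k, Finset.mul_sum, ← mul_assoc]
    exact hasSum_sum fun j _ => hasSum_matrix_mul_right _ (ih j)

theorem hasSum_blockPow_succ {i k : ℕ} (hs : Summable fun n => blockPow T n i k) :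
    HasSum (fun n => blockPow T (n + 1) i k) (minInv T i k - (1 : BlockMatrix m) i k) := by
  have h := (hasSum_nat_add_iff' (f := fun n => blockPow T n i k) 1).2 hs.hasSum
  rwa [Finset.sum_range_one] at h

theorem hasSum_mul_minInv (hT : 0 ≤ T) (hH : IsUpperHessenberg T)
    (hs : ∀ i k, Summable fun n => blockPow T n i k) (i k : ℕ) :
    HasSum (fun j => T i j * minInv T j k) (minInv T i k - (1 : BlockMatrix m) i k) :=
  hasSum_comm_of_nonneg (fun n j => matrix_mul_nonneg (hT i j) (blockPow_nonneg hT n j k))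
    (fun n => hasSum_mul_blockPow hH n i k) (fun j => hasSum_matrix_mul_left _ (hs j k).hasSum)
    (hasSum_blockPow_succ (hs i k))

theorem hasSum_minInv_mul (hH : IsUpperHessenberg T)
    (hs : ∀ i k, Summable fun n => blockPow T n i k) (i k : ℕ) :
    HasSum (fun j => minInv T i j * T j k) (minInv T i k - (1 : BlockMatrix m) i k) := by
  have hsum : HasSum (fun n => blockPow T (n + 1) i k)
      (∑ j ∈ Finset.range (k + 2), minInv T i j * T j k) := by
    simp only [blockPow_succ hH]
    exact hasSum_sum fun j _ => hasSum_matrix_mul_right _ (hs i j).hasSum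
  rw [(hasSum_blockPow_succ (hs i k)).unique hsum]
  exact hasSum_sum_of_ne_finset_zero fun j hj => by
    rw [hH (by rw [Finset.mem_range] at hj; omega), mul_zero]

theorem hasMinInv_of_summable (hT : 0 ≤ T) (hH : IsUpperHessenberg T)
    (hs : ∀ i k, Summable fun n => blockPow T n i k) : HasMinInv T := by
  refine ⟨hs, fun i k => ?_, fun i k => ?_⟩
  · simpa only [Matrix.sub_apply, sub_mul, sub_sub_cancel] using
      (hasSum_one_mul (minInv T) i k).sub (hasSum_mul_minInv hT hH hs i k)
  · simpa only [Matrix.sub_apply, mul_sub, sub_sub_cancel] using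
      (hasSum_mul_one (minInv T) i k).sub (hasSum_minInv_mul hH hs i k)

theorem hasSum_vecMul_blockPow (hH : IsUpperHessenberg T) (b : ℕ → Fin m → ℝ) (n k : ℕ) :
    HasSum (fun i => b i ᵥ* blockPow T n i k) ((vecStep T ^ n) b k) := by
  induction n generalizing k with
  | zero =>
    convert hasSum_single k fun j hj => ?_
    · simp [blockPow]
    · simp [blockPow, Matrix.one_apply_ne hj]
  | succ n ih =>
    simp only [vecStep_pow_succ_apply, vecStep_apply, blockPow_succ hH, Matrix.vecMul_sum,
      ← Matrix.vecMul_vecMul]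
    exact hasSum_sum fun j _ => hasSum_vecMul_right _ (ih j)

theorem vecStep_pow_single (hH : IsUpperHessenberg T) (i : ℕ) (v : Fin m → ℝ) (n k : ℕ) :
    (vecStep T ^ n) (Pi.single i v) k = v ᵥ* blockPow T n i k := by
  refine (hasSum_vecMul_blockPow hH _ n k).unique ?_
  convert hasSum_single i fun j hj => ?_
  · rw [Pi.single_eq_same]
  · rw [Pi.single_eq_of_ne hj, Matrix.zero_vecMul]

theorem mul_blockPow_le (hT : 0 ≤ T) (hH : IsUpperHessenberg T) {b : ℕ → Fin m → ℝ} (hb : 0 ≤ b)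
    (n i k : ℕ) (a d : Fin m) : b i a * blockPow T n i k a d ≤ (vecStep T ^ n) b k d :=
  (mul_le_vecMul (hb i) (blockPow_nonneg hT n i k) a d).trans <|
    le_hasSum (hasSum_vecMul_blockPow hH b n k) i
      (fun j _ => vecMul_nonneg (hb j) (blockPow_nonneg hT n j k)) d

theorem summable_vecStep_pow (hT : 0 ≤ T) {b w : ℕ → Fin m → ℝ} (hb : 0 ≤ b) (hw : 0 ≤ w)
    (h : w = b + vecStep T w) : Summable fun n => (vecStep T ^ n) b :=
  summable_of_nonneg_of_sum_range_le (c := w) (vecStep_pow_nonneg hT hb) fun n => by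
    conv_rhs => rw [eq_sum_pow_apply_add h n]
    exact le_add_of_nonneg_right (vecStep_pow_nonneg hT hw n)

theorem vecStep_pow_le (hT : 0 ≤ T) {b w : ℕ → Fin m → ℝ} (hb : 0 ≤ b)
    (h : w = b + vecStep T w) (n : ℕ) : (vecStep T ^ n) w ≤ w := by
  conv_rhs => rw [eq_sum_pow_apply_add h n]
  exact le_add_of_nonneg_left (Finset.sum_nonneg fun i _ => vecStep_pow_nonneg hT hb i)

theorem exists_tendsto_vecStep_pow (hT : 0 ≤ T) {b w : ℕ → Fin m → ℝ} (hb : 0 ≤ b) (hw : 0 ≤ w)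
    (h : w = b + vecStep T w) : ∃ z, 0 ≤ z ∧ z ≤ w ∧ vecStep T z = z ∧
      Tendsto (fun n => (vecStep T ^ n) w) atTop (𝓝 z) := by
  obtain ⟨s, hs⟩ := summable_vecStep_pow hT hb hw h
  have hlim : Tendsto (fun n => (vecStep T ^ n) w) atTop (𝓝 (w - s)) :=
    (hs.tendsto_sum_nat.const_sub w).congr fun n => sub_eq_of_eq_add' (eq_sum_pow_apply_add h n)
  refine ⟨w - s, ge_of_tendsto' hlim (vecStep_pow_nonneg hT hw),
    sub_le_self _ (hs.nonneg (vecStep_pow_nonneg hT hb)),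
    tendsto_nhds_unique (((continuous_vecStep T).tendsto _).comp hlim) ?_, hlim⟩
  simpa only [Function.comp_def, ← vecStep_pow_succ_apply] using
    hlim.comp (tendsto_add_atTop_nat 1)

theorem summable_blockPow_of_reachable (hT : 0 ≤ T) (hH : IsUpperHessenberg T)
    {b w : ℕ → Fin m → ℝ} (hb : 0 ≤ b) (hw : 0 ≤ w) (h : w = b + vecStep T w)
    (hreach : ∀ i a, ∃ n, 0 < (vecStep T ^ n) b i a) (i k : ℕ) :
    Summable fun n => blockPow T n i k := by
  refine matrix_summable_iff.2 fun a d => ?_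
  obtain ⟨l, hl⟩ := hreach i a
  have hs := Pi.summable.1 (Pi.summable.1 (summable_vecStep_pow hT hb hw h) k) d
  refine Summable.of_nonneg_of_le (fun n => blockPow_nonneg hT n i k a d) (fun n => ?_)
    (((summable_nat_add_iff l).2 hs).mul_left ((vecStep T ^ l) b i a)⁻¹)
  rw [inv_mul_eq_div, le_div_iff₀' hl, pow_add, Module.End.mul_apply]
  exact mul_blockPow_le hT hH (vecStep_pow_nonneg hT hb l) n i k a d

theorem hasSum_vecStep_pow (hT : 0 ≤ T) {b w : ℕ → Fin m → ℝ} (hb : 0 ≤ b)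
    (h : w = b + vecStep T w) (hlim : Tendsto (fun n => (vecStep T ^ n) w) atTop (𝓝 0)) :
    HasSum (fun n => (vecStep T ^ n) b) w := by
  refine hasSum_of_nonneg_of_tendsto_sum_range (vecStep_pow_nonneg hT hb) ?_
  have hpartial := hlim.const_sub w
  rw [sub_zero] at hpartial
  exact hpartial.congr fun n => sub_eq_of_eq_add (eq_sum_pow_apply_add h n)

theorem isVecMul_minInv (hT : 0 ≤ T) (hH : IsUpperHessenberg T)
    (hs : ∀ i k, Summable fun n => blockPow T n i k) {b w : ℕ → Fin m → ℝ} (hb : 0 ≤ b)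
    (hw : HasSum (fun n => (vecStep T ^ n) b) w) : IsVecMul b (minInv T) w := fun k =>
  hasSum_comm_of_nonneg (fun n i => vecMul_nonneg (hb i) (blockPow_nonneg hT n i k))
    (fun n => hasSum_vecMul_blockPow hH b n k) (fun i => hasSum_vecMul_left _ (hs i k).hasSum)
    (Pi.hasSum.1 hw k)

theorem summable_blockPow_of_summable_single (hH : IsUpperHessenberg T) {i k : ℕ}
    (h : ∀ v, Summable fun n => (vecStep T ^ n) (Pi.single i v) k) :
    Summable fun n => blockPow T n i k :=
  matrix_summable_iff.2 fun a d => by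
    simpa [vecStep_pow_single hH] using Pi.summable.1 (h (Pi.single a 1)) d

/-! ### Diagonal, subdiagonal and strictly upper triangular block matrices -/

theorem isUpperHessenberg_diagonal (d : ℕ → Matrix (Fin m) (Fin m) ℝ) :
    IsUpperHessenberg (Matrix.diagonal d) := fun _ _ hij =>
  Matrix.diagonal_apply_ne _ (by omega)

theorem diagonal_nonneg {d : ℕ → Matrix (Fin m) (Fin m) ℝ} (hd : 0 ≤ d) :
    0 ≤ Matrix.diagonal d := fun i j => by
  rw [Matrix.diagonal_apply]
  split_ifs
  exacts [hd i, le_rfl]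

theorem vecStep_diagonal_pow (d : ℕ → Matrix (Fin m) (Fin m) ℝ) (n : ℕ) (w : ℕ → Fin m → ℝ)
    (k : ℕ) : (vecStep (Matrix.diagonal d) ^ n) w k = w k ᵥ* d k ^ n := by
  induction n with
  | zero => simp
  | succ n ih =>
    rw [vecStep_pow_succ_apply, vecStep_apply, Finset.sum_eq_single_of_mem k (by simp)
      fun j _ hj => by rw [Matrix.diagonal_apply_ne _ hj, Matrix.vecMul_zero], ih,
      Matrix.diagonal_apply_eq, Matrix.vecMul_vecMul, pow_succ]

theorem summable_blockPow_diagonal {d : ℕ → Matrix (Fin m) (Fin m) ℝ}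
    (hd : ∀ k, Summable fun n => d k ^ n) (i k : ℕ) :
    Summable fun n => blockPow (Matrix.diagonal d) n i k :=
  summable_blockPow_of_summable_single (isUpperHessenberg_diagonal d) fun v => by
    simpa only [vecStep_diagonal_pow] using (hasSum_vecMul_left _ (hd k).hasSum).summable

theorem isVecMul_minInv_diagonal {d : ℕ → Matrix (Fin m) (Fin m) ℝ} (hd0 : 0 ≤ d)
    (hd : ∀ k, Summable fun n => d k ^ n) {u : ℕ → Fin m → ℝ} (hu : 0 ≤ u) :
    IsVecMul u (minInv (Matrix.diagonal d)) fun k => u k ᵥ* (1 - d k)⁻¹ :=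
  isVecMul_minInv (diagonal_nonneg hd0) (isUpperHessenberg_diagonal d)
    (summable_blockPow_diagonal hd) hu <| Pi.hasSum.2 fun k => by
      simpa only [vecStep_diagonal_pow] using
        hasSum_vecMul_left (u k) (hasSum_pow_inv_one_sub (hd k))

/-- The block matrix all of whose blocks just below the diagonal are `G`, the others being `0`. -/
def subdiagonal (G : Matrix (Fin m) (Fin m) ℝ) : BlockMatrix m :=
  fun i j => if i = j + 1 then G else 0

theorem subdiagonal_nonneg {G : Matrix (Fin m) (Fin m) ℝ} (hG : 0 ≤ G) : 0 ≤ subdiagonal G :=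
  fun i j => by
    rw [subdiagonal]
    split_ifs
    exacts [hG, le_rfl]

theorem isUpperHessenberg_subdiagonal (G : Matrix (Fin m) (Fin m) ℝ) :
    IsUpperHessenberg (subdiagonal G) := fun _ _ hij => if_neg (by omega)

theorem vecStep_subdiagonal (G : Matrix (Fin m) (Fin m) ℝ) (w : ℕ → Fin m → ℝ) (k : ℕ) :
    vecStep (subdiagonal G) w k = w (k + 1) ᵥ* G := by
  rw [vecStep_apply, Finset.sum_eq_single_of_mem (k + 1) (by simp), subdiagonal, if_pos rfl]
  intro j _ hj
  rw [subdiagonal, if_neg hj, Matrix.vecMul_zero]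

theorem vecStep_subdiagonal_pow (G : Matrix (Fin m) (Fin m) ℝ) (n : ℕ) (w : ℕ → Fin m → ℝ)
    (k : ℕ) : (vecStep (subdiagonal G) ^ n) w k = w (k + n) ᵥ* G ^ n := by
  induction n generalizing k with
  | zero => simp
  | succ n ih =>
    rw [vecStep_pow_succ_apply, vecStep_subdiagonal, ih, Matrix.vecMul_vecMul, ← pow_succ,
      add_right_comm, add_assoc]

theorem summable_blockPow_subdiagonal (G : Matrix (Fin m) (Fin m) ℝ) (i k : ℕ) :
    Summable fun n => blockPow (subdiagonal G) n i k :=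
  summable_blockPow_of_summable_single (isUpperHessenberg_subdiagonal G) fun v =>
    summable_of_ne_finset_zero (s := Finset.range (i + 1)) fun n hn => by
      rw [vecStep_subdiagonal_pow, Pi.single_eq_of_ne, Matrix.zero_vecMul]
      rw [Finset.mem_range] at hn
      omega

/-- `T` vanishes on and below the diagonal. -/
def IsStrictlyUpper (T : BlockMatrix m) : Prop := ∀ ⦃i j⦄, j ≤ i → T i j = 0

theorem IsStrictlyUpper.isUpperHessenberg (hT : IsStrictlyUpper T) : IsUpperHessenberg T :=
  fun _ _ hij => hT (by omega)

theorem IsStrictlyUpper.vecStep_pow_eq_zero (hT : IsStrictlyUpper T) (w : ℕ → Fin m → ℝ)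
    {n k : ℕ} (hk : k < n) : (vecStep T ^ n) w k = 0 := by
  induction n generalizing k with
  | zero => omega
  | succ n ih =>
    rw [vecStep_pow_succ_apply, vecStep_apply]
    refine Finset.sum_eq_zero fun j _ => ?_
    rcases lt_or_ge j k with hjk | hkj
    · rw [ih (by omega), Matrix.zero_vecMul]
    · rw [hT hkj, Matrix.vecMul_zero]

theorem IsStrictlyUpper.tendsto_vecStep_pow (hT : IsStrictlyUpper T) (w : ℕ → Fin m → ℝ) :
    Tendsto (fun n => (vecStep T ^ n) w) atTop (𝓝 0) :=
  tendsto_pi_nhds.2 fun k => tendsto_const_nhds.congr' <|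
    (eventually_gt_atTop k).mono fun _ hn => (hT.vecStep_pow_eq_zero w hn).symm

theorem IsStrictlyUpper.summable_blockPow (hT : IsStrictlyUpper T) (i k : ℕ) :
    Summable fun n => blockPow T n i k :=
  summable_blockPow_of_summable_single hT.isUpperHessenberg fun v =>
    summable_of_ne_finset_zero (s := Finset.range (k + 1)) fun _ hn =>
      hT.vecStep_pow_eq_zero _ (by simpa using hn)

end BlockMatrix

namespace Blocks

variable {m₀ m : ℕ} {D : Blocks m₀ m} {G : Matrix (Fin m) (Fin m) ℝ}

/-- The iterates `0, F 0, F (F 0), …` of `F H = ∑_{k ≥ 0} A_k Hᵏ`; they increase to `G`. -/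
def minimalIterate (D : Blocks m₀ m) : ℕ → Matrix (Fin m) (Fin m) ℝ
  | 0 => 0
  | n + 1 => ∑' k, D.A k * minimalIterate D n ^ k

theorem summable_A_mul_pow_of_le (hA : ∀ k, 0 ≤ D.A k) (hG : HasSum (fun k => D.A k * G ^ k) G)
    {H : Matrix (Fin m) (Fin m) ℝ} (hH : 0 ≤ H) (hHG : H ≤ G) :
    Summable fun k => D.A k * H ^ k :=
  summable_of_nonneg_of_le (fun k => mul_nonneg (hA k) (pow_nonneg hH k))
    (fun k => matrix_mul_le_mul_left (hA k) (pow_le_pow_left₀ hH hHG k)) hG.summable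

theorem minimalIterate_mem_Icc (hA : ∀ k, 0 ≤ D.A k) (hG0 : 0 ≤ G)
    (hG : HasSum (fun k => D.A k * G ^ k) G) (n : ℕ) : D.minimalIterate n ∈ Set.Icc 0 G := by
  induction n with
  | zero => exact ⟨le_rfl, hG0⟩
  | succ n ih =>
    exact ⟨tsum_nonneg fun k => mul_nonneg (hA k) (pow_nonneg ih.1 k),
      hasSum_le (fun k => matrix_mul_le_mul_left (hA k) (pow_le_pow_left₀ ih.1 ih.2 k))
        (summable_A_mul_pow_of_le hA hG ih.1 ih.2).hasSum hG⟩

theorem hasSum_minimalIterate_succ (hA : ∀ k, 0 ≤ D.A k) (hG0 : 0 ≤ G)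
    (hG : HasSum (fun k => D.A k * G ^ k) G) (n : ℕ) :
    HasSum (fun k => D.A k * D.minimalIterate n ^ k) (D.minimalIterate (n + 1)) :=
  have hmem := minimalIterate_mem_Icc hA hG0 hG n
  (summable_A_mul_pow_of_le hA hG hmem.1 hmem.2).hasSum

theorem monotone_minimalIterate (hA : ∀ k, 0 ≤ D.A k) (hG0 : 0 ≤ G)
    (hG : HasSum (fun k => D.A k * G ^ k) G) : Monotone D.minimalIterate := by
  have hmem := minimalIterate_mem_Icc hA hG0 hG
  refine monotone_nat_of_le_succ fun n => ?_
  induction n with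
  | zero => exact (hmem 1).1
  | succ n ih =>
    exact hasSum_le
      (fun k => matrix_mul_le_mul_left (hA k) (pow_le_pow_left₀ (hmem n).1 ih k))
      (hasSum_minimalIterate_succ hA hG0 hG n) (hasSum_minimalIterate_succ hA hG0 hG (n + 1))

theorem tendsto_minimalIterate (hA : ∀ k, 0 ≤ D.A k) (hG : D.IsMinimalSolution G) :
    Tendsto D.minimalIterate atTop (𝓝 G) := by
  have hmem := minimalIterate_mem_Icc hA hG.1 hG.2.1
  have hmono := monotone_minimalIterate hA hG.1 hG.2.1
  have hstep := hasSum_minimalIterate_succ hA hG.1 hG.2.1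
  have hbdd : BddAbove (Set.range D.minimalIterate) :=
    ⟨G, Set.forall_mem_range.2 fun n => (hmem n).2⟩
  set H := ⨆ n, D.minimalIterate n
  have hlim : Tendsto D.minimalIterate atTop (𝓝 H) := tendsto_atTop_ciSup hmono hbdd
  have hle : ∀ n, D.minimalIterate n ≤ H := hmono.ge_of_tendsto hlim
  have hH0 : 0 ≤ H := hle 0
  have hHG : H ≤ G := le_of_tendsto' hlim fun n => (hmem n).2
  obtain ⟨S, hS⟩ := summable_A_mul_pow_of_le hA hG.2.1 hH0 hHG
  have hSH : S ≤ H := hasSum_le_of_sum_le hS fun s =>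
    le_of_tendsto_of_tendsto' (tendsto_finsetSum s fun k _ => (hlim.pow k).const_mul (D.A k))
      (hlim.comp (tendsto_add_atTop_nat 1)) fun n =>
        sum_le_hasSum s (fun k _ => mul_nonneg (hA k) (pow_nonneg (hmem n).1 k)) (hstep n)
  have hHS : H ≤ S := le_of_tendsto' (hlim.comp (tendsto_add_atTop_nat 1)) fun n =>
    hasSum_le (fun k => matrix_mul_le_mul_left (hA k) (pow_le_pow_left₀ (hmem n).1 (hle n) k))
      (hstep n) hS
  rw [le_antisymm hSH hHS] at hS
  rwa [le_antisymm hHG (hG.2.2 H hH0 hS)] at hlim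

theorem pow_mul_le_of_mul_le {q : Type*} {H : Matrix (Fin m) (Fin m) ℝ}
    {N : ℕ → Matrix (Fin m) q ℝ} (hH : 0 ≤ H) (h : ∀ j, H * N j ≤ N (j + 1)) (k j : ℕ) :
    H ^ k * N j ≤ N (j + k) := by
  induction k with
  | zero => simp
  | succ k ih =>
    rw [pow_succ', Matrix.mul_assoc]
    exact (matrix_mul_le_mul_left hH ih).trans (h (j + k))

theorem pow_mul_le {q : Type*} {N N' : ℕ → Matrix (Fin m) q ℝ} (hA : ∀ k, 0 ≤ D.A k)
    (hG : D.IsMinimalSolution G) (hN : ∀ j, 0 ≤ N j)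
    (hN' : ∀ j, HasSum (fun l => D.A l * N (j + l)) (N' j)) (hle : ∀ j, N' j ≤ N (j + 1))
    (k j : ℕ) : G ^ k * N j ≤ N (j + k) := by
  have hmem := minimalIterate_mem_Icc hA hG.1 hG.2.1
  have hiter : ∀ n j, D.minimalIterate n * N j ≤ N (j + 1) := fun n => by
    induction n with
    | zero => intro j; simpa [minimalIterate] using hN (j + 1)
    | succ n ih =>
      refine fun j => (hasSum_le (fun l => ?_) (hasSum_matrix_mul_right (N j)
        (hasSum_minimalIterate_succ hA hG.1 hG.2.1 n)) (hN' j)).trans (hle j)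
      rw [Matrix.mul_assoc]
      exact matrix_mul_le_mul_left (hA l) (pow_mul_le_of_mul_le (hmem n).1 ih l j)
  refine pow_mul_le_of_mul_le hG.1 (fun j => ?_) k j
  have hcont : Continuous fun M : Matrix (Fin m) (Fin m) ℝ => M * N j :=
    continuous_id.matrix_mul continuous_const
  exact le_of_tendsto' ((hcont.tendsto G).comp (tendsto_minimalIterate hA hG)) fun n => hiter n j

end Blocks

/-- The matrix all of whose entries are `1`. -/
def ones (p q : Type*) : Matrix p q ℝ := Matrix.of fun _ _ => 1

theorem Blocks.pow_le_ones {m₀ m : ℕ} {D : Blocks m₀ m} {G : Matrix (Fin m) (Fin m) ℝ}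
    (hA : ∀ k, 0 ≤ D.A k) (hrow : HasSum (fun k => D.A k * ones (Fin m) (Fin m)) (ones _ _))
    (hG : D.IsMinimalSolution G) (k : ℕ) : G ^ k ≤ ones _ _ := by
  have hones : (0 : Matrix (Fin m) (Fin m) ℝ) ≤ ones _ _ := fun _ _ => zero_le_one
  have hone : (1 : Matrix (Fin m) (Fin m) ℝ) ≤ ones _ _ := fun a b => by
    rw [Matrix.one_apply]
    exact ite_le_one le_rfl zero_le_one
  calc G ^ k = G ^ k * 1 := (mul_one _).symm
    _ ≤ G ^ k * ones _ _ := matrix_mul_le_mul_left (pow_nonneg hG.1 k) hone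
    _ ≤ ones _ _ := Blocks.pow_mul_le (N := fun _ => ones _ _) hA hG (fun _ => hones)
      (fun _ => hrow) (fun _ => le_rfl) k 0

theorem summable_mul_of_le_ones {p q r : Type*} [Fintype q] {C : ℕ → Matrix p q ℝ}
    {M : ℕ → Matrix q r ℝ} (hC : ∀ k, 0 ≤ C k) (hs : Summable C) (hM : ∀ k, 0 ≤ M k)
    (hM1 : ∀ k, M k ≤ ones _ _) : Summable fun k => C k * M k :=
  summable_of_nonneg_of_le (fun k => matrix_mul_nonneg (hC k) (hM k))
    (fun k => matrix_mul_le_mul_left (hC k) (hM1 k)) (hasSum_matrix_mul_right _ hs.hasSum).summable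

theorem tendsto_vecMul_of_le_ones {p q : Type*} [Fintype p] {u : ℕ → p → ℝ}
    {M : ℕ → Matrix p q ℝ} (hu : Tendsto u atTop (𝓝 0)) (hM : ∀ k, 0 ≤ M k)
    (hM1 : ∀ k, M k ≤ ones _ _) : Tendsto (fun k => u k ᵥ* M k) atTop (𝓝 0) := by
  refine tendsto_pi_nhds.2 fun b => ?_
  have hbdd : ∀ a, IsBoundedUnder (· ≤ ·) atTop fun k => |M k a b| := fun a =>
    isBoundedUnder_of ⟨1, fun k => (abs_of_nonneg (hM k a b)).trans_le (hM1 k a b)⟩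
  have hsum := tendsto_finsetSum Finset.univ fun a _ =>
    (tendsto_pi_nhds.1 hu a).zero_mul_isBoundedUnder_le (hbdd a)
  rw [Finset.sum_const_zero] at hsum
  exact hsum

section GMeasure

variable {m : ℕ} {T : BlockMatrix m} {A : ℕ → Matrix (Fin m) (Fin m) ℝ}
  {G : Matrix (Fin m) (Fin m) ℝ} {β y : ℕ → Fin m → ℝ}

/-- On and above the subdiagonal, `T` has the constant diagonals `A` in all rows but the first. -/
def HasToeplitzRows (T : BlockMatrix m) (A : ℕ → Matrix (Fin m) (Fin m) ℝ) : Prop :=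
  ∀ ⦃i k⦄, i ≤ k → T (i + 1) k = A (k - i)

theorem HasToeplitzRows.vecStep_eq (hA : HasToeplitzRows T A) (k : ℕ) :
    vecStep T y k =
      ∑ i ∈ Finset.range (k + 1), y (i + 1) ᵥ* A (k - i) + y 0 ᵥ* T 0 k := by
  rw [vecStep_apply, Finset.sum_range_succ']
  congr 1
  refine Finset.sum_congr rfl fun i hi => ?_
  rw [hA (Finset.mem_range_succ_iff.1 hi)]

theorem HasToeplitzRows.tendsto_vecStep (hT : HasToeplitzRows T A) (hA : Summable A)
    (hrow : Tendsto (T 0) atTop (𝓝 0)) (hy : Tendsto y atTop (𝓝 0)) :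
    Tendsto (vecStep T y) atTop (𝓝 0) := by
  have hToeplitz := tendsto_sum_range_vecMul_sub (hy.comp (tendsto_add_atTop_nat 1)) hA
  have hfirst : Tendsto (fun k => y 0 ᵥ* T 0 k) atTop (𝓝 (y 0 ᵥ* 0)) :=
    ((continuous_const.matrix_vecMul continuous_id).tendsto 0).comp hrow
  have hsum := hToeplitz.add hfirst
  rw [Matrix.vecMul_zero, add_zero] at hsum
  exact hsum.congr fun k => (hT.vecStep_eq k).symm

/-- The matrix with blocks `W_{i,k} = ∑ₗ T_{i,k+l} Gˡ`. If `G` describes the first passage from each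
level to the one below, then `W_{i,k}` describes the transitions from `i` into `k` of the chain that
is watched only while it is at levels up to `k`. -/
def censored (T : BlockMatrix m) (G : Matrix (Fin m) (Fin m) ℝ) : BlockMatrix m :=
  fun i k => ∑' l, T i (k + l) * G ^ l

/-- `G` is the (level-independent) `G`-measure of the nonnegative upper Hessenberg matrix `T`, and
the chain with transitions `T` is transient within each level when watched below that level. -/
structure HasGMeasure (T : BlockMatrix m) (G : Matrix (Fin m) (Fin m) ℝ) : Prop where
  nonneg : 0 ≤ T
  isUpperHessenberg : IsUpperHessenberg T
  g_nonneg : 0 ≤ G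
  summable : ∀ i k, Summable fun l => T i (k + l) * G ^ l
  censored_succ : ∀ k, censored T G (k + 1) k = G
  summable_censored_pow : ∀ k, Summable fun n => censored T G k k ^ n

/-- The `R`-measure `W_{i,k} (I - W_{k,k})⁻¹`, `i < k`, of `T`. -/
def rMeasure (T : BlockMatrix m) (G : Matrix (Fin m) (Fin m) ℝ) : BlockMatrix m := fun i k =>
  if i < k then censored T G i k * (1 - censored T G k k)⁻¹ else 0

theorem isStrictlyUpper_rMeasure (T : BlockMatrix m) (G : Matrix (Fin m) (Fin m) ℝ) :
    IsStrictlyUpper (rMeasure T G) := fun _ _ hij => if_neg hij.not_gt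

/-- The vector `u` for which `y = u (I - Ψ_D)⁻¹ (I - R_U)⁻¹`. -/
def ladderResidual (T : BlockMatrix m) (G : Matrix (Fin m) (Fin m) ℝ) (y : ℕ → Fin m → ℝ) :
    ℕ → Fin m → ℝ :=
  fun k => y k - ∑ i ∈ Finset.range (k + 1), y i ᵥ* censored T G i k

namespace HasGMeasure

theorem hasSum_censored (h : HasGMeasure T G) (i k : ℕ) :
    HasSum (fun l => T i (k + l) * G ^ l) (censored T G i k) :=
  (h.summable i k).hasSum

theorem censored_nonneg (h : HasGMeasure T G) : 0 ≤ censored T G := fun i k =>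
  (h.hasSum_censored i k).nonneg fun l => mul_nonneg (h.nonneg i (k + l)) (pow_nonneg h.g_nonneg l)

theorem hasSum_censored_succ_mul (h : HasGMeasure T G) (i k : ℕ) :
    HasSum (fun l => T i (k + (l + 1)) * G ^ (l + 1)) (censored T G i (k + 1) * G) := by
  have hmul := (h.hasSum_censored i (k + 1)).mul_right G
  simpa only [mul_assoc, ← pow_succ, add_assoc, add_comm 1] using hmul

theorem censored_eq_add (h : HasGMeasure T G) (i k : ℕ) :
    censored T G i k = T i k + censored T G i (k + 1) * G := by
  have hsum := (hasSum_nat_add_iff' 1).2 (h.hasSum_censored i k)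
  rw [Finset.sum_range_one, add_zero, pow_zero, mul_one] at hsum
  rw [(h.hasSum_censored_succ_mul i k).unique hsum, add_sub_cancel]

theorem inv_one_sub_censored_nonneg (h : HasGMeasure T G) (k : ℕ) :
    0 ≤ (1 - censored T G k k)⁻¹ :=
  (hasSum_pow_inv_one_sub (h.summable_censored_pow k)).nonneg
    (pow_nonneg (h.censored_nonneg k k))

theorem rMeasure_nonneg (h : HasGMeasure T G) : 0 ≤ rMeasure T G := fun i k => by
  rw [rMeasure]
  split_ifs
  exacts [mul_nonneg (h.censored_nonneg i k) (h.inv_one_sub_censored_nonneg k), le_rfl]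

theorem shift (h : HasGMeasure T G) : HasGMeasure (fun i k => T (i + 1) (k + 1)) G := by
  have hW : ∀ i k, HasSum (fun l => T (i + 1) (k + l + 1) * G ^ l) (censored T G (i + 1) (k + 1)) :=
    fun i k => by simpa only [add_right_comm k 1] using h.hasSum_censored (i + 1) (k + 1)
  have hcensored : ∀ i k, censored (fun i k => T (i + 1) (k + 1)) G i k =
      censored T G (i + 1) (k + 1) := fun i k => (hW i k).tsum_eq
  exact
    { nonneg := fun i k => h.nonneg (i + 1) (k + 1)
      isUpperHessenberg := fun i j hij => h.isUpperHessenberg (Nat.succ_lt_succ hij)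
      g_nonneg := h.g_nonneg
      summable := fun i k => (hW i k).summable
      censored_succ := fun k => (hcensored _ _).trans (h.censored_succ (k + 1))
      summable_censored_pow := fun k => by
        rw [hcensored]
        exact h.summable_censored_pow (k + 1) }

theorem ladderResidual_eq_add (h : HasGMeasure T G) (hy : y = β + vecStep T y) :
    ladderResidual T G y = β + vecStep (subdiagonal G) (ladderResidual T G y) := by
  funext k
  have hT : T (k + 1) k = G - censored T G (k + 1) (k + 1) * G := by
    rw [eq_sub_iff_add_eq, ← h.censored_eq_add, h.censored_succ]
  have hyk : y k = β k + (∑ i ∈ Finset.range (k + 1), y i ᵥ* T i k + y (k + 1) ᵥ* T (k + 1) k) := by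
    rw [← Finset.sum_range_succ, ← vecStep_apply]
    exact congrFun hy k
  rw [Pi.add_apply, vecStep_subdiagonal, ladderResidual, ladderResidual, hyk, hT]
  simp only [h.censored_eq_add _ k, Matrix.vecMul_add, Matrix.vecMul_sub, Matrix.sub_vecMul,
    Matrix.sum_vecMul, Matrix.add_vecMul, Matrix.vecMul_vecMul, Finset.sum_add_distrib,
    Finset.sum_range_succ _ (k + 1)]
  abel

theorem eq_add_vecStep_rMeasure (h : HasGMeasure T G) (y : ℕ → Fin m → ℝ) :
    y = (fun k => ladderResidual T G y k ᵥ* (1 - censored T G k k)⁻¹) +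
      vecStep (rMeasure T G) y := by
  funext k
  have hunit := isUnit_one_sub_of_summable_pow (h.summable_censored_pow k)
  have hR : vecStep (rMeasure T G) y k =
      (∑ i ∈ Finset.range k, y i ᵥ* censored T G i k) ᵥ* (1 - censored T G k k)⁻¹ := by
    rw [vecStep_apply, Finset.sum_range_succ, Finset.sum_range_succ, rMeasure, rMeasure,
      if_neg (by omega), if_neg (by omega), Matrix.vecMul_zero, Matrix.vecMul_zero, add_zero,
      add_zero, Matrix.sum_vecMul]
    refine Finset.sum_congr rfl fun i hi => ?_
    rw [rMeasure, if_pos (Finset.mem_range.1 hi), Matrix.vecMul_vecMul]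
  have hresidual : ladderResidual T G y k + ∑ i ∈ Finset.range k, y i ᵥ* censored T G i k =
      y k ᵥ* (1 - censored T G k k) := by
    rw [ladderResidual, Finset.sum_range_succ, Matrix.vecMul_sub, Matrix.vecMul_one]
    abel
  rw [Pi.add_apply, hR, ← Matrix.add_vecMul, hresidual, Matrix.vecMul_vecMul,
    Matrix.mul_nonsing_inv _ ((Matrix.isUnit_iff_isUnit_det _).1 hunit), Matrix.vecMul_one]

theorem tendsto_ladderResidual {Q : ℕ → Matrix (Fin m) (Fin m) ℝ} (h : HasGMeasure T G)
    (hW : HasToeplitzRows (censored T G) Q) (hQ : Summable Q)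
    (hrow : Tendsto (censored T G 0) atTop (𝓝 0)) (hy : Tendsto y atTop (𝓝 0)) :
    Tendsto (ladderResidual T G y) atTop (𝓝 0) := by
  have hnext : Tendsto (fun k => y (k + 1) ᵥ* G) atTop (𝓝 (0 ᵥ* G)) :=
    ((continuous_id.matrix_vecMul continuous_const).tendsto 0).comp
      (hy.comp (tendsto_add_atTop_nat 1))
  have hlim := (hy.sub (hW.tendsto_vecStep hQ hrow hy)).add hnext
  rw [Matrix.zero_vecMul, sub_zero, add_zero] at hlim
  refine hlim.congr fun k => ?_
  rw [ladderResidual, vecStep_apply, Finset.sum_range_succ, h.censored_succ]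
  abel

theorem tendsto_vecStep_subdiagonal_pow {u : ℕ → Fin m → ℝ} (hG : 0 ≤ G)
    (hG1 : ∀ k, G ^ k ≤ ones _ _) (hu : Tendsto u atTop (𝓝 0)) :
    Tendsto (fun n => (vecStep (subdiagonal G) ^ n) u) atTop (𝓝 0) :=
  tendsto_pi_nhds.2 fun k => by
    simp only [vecStep_subdiagonal_pow]
    refine tendsto_vecMul_of_le_ones ?_ (pow_nonneg hG) hG1
    simpa only [Function.comp_def, add_comm k] using hu.comp (tendsto_add_atTop_nat k)

theorem hasSum_ladderResidual (h : HasGMeasure T G) (hG1 : ∀ k, G ^ k ≤ ones _ _) (hβ : 0 ≤ β)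
    (hy : y = β + vecStep T y) (hlim : Tendsto (ladderResidual T G y) atTop (𝓝 0)) (k : ℕ) :
    HasSum (fun n => β (k + n) ᵥ* G ^ n) (ladderResidual T G y k) := by
  have hsum := Pi.hasSum.1 (hasSum_vecStep_pow (subdiagonal_nonneg h.g_nonneg) hβ
    (h.ladderResidual_eq_add hy) (tendsto_vecStep_subdiagonal_pow h.g_nonneg hG1 hlim)) k
  simpa only [vecStep_subdiagonal_pow] using hsum

theorem isVecMul_ladderResidual (h : HasGMeasure T G) (hG1 : ∀ k, G ^ k ≤ ones _ _) (hβ : 0 ≤ β)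
    (hy : y = β + vecStep T y) (hlim : Tendsto (ladderResidual T G y) atTop (𝓝 0)) :
    IsVecMul β (minInv (subdiagonal G)) (ladderResidual T G y) ∧
    IsVecMul (ladderResidual T G y) (minInv (Matrix.diagonal fun k => censored T G k k))
      (fun k => ladderResidual T G y k ᵥ* (1 - censored T G k k)⁻¹) ∧
    IsVecMul (fun k => ladderResidual T G y k ᵥ* (1 - censored T G k k)⁻¹)
      (minInv (rMeasure T G)) y := by
  have hu : 0 ≤ ladderResidual T G y := fun k =>
    (h.hasSum_ladderResidual hG1 hβ hy hlim k).nonneg fun n =>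
      vecMul_nonneg (hβ (k + n)) (pow_nonneg h.g_nonneg n)
  have hv : 0 ≤ fun k => ladderResidual T G y k ᵥ* (1 - censored T G k k)⁻¹ := fun k =>
    vecMul_nonneg (hu k) (h.inv_one_sub_censored_nonneg k)
  refine ⟨isVecMul_minInv (subdiagonal_nonneg h.g_nonneg) (isUpperHessenberg_subdiagonal G)
      (summable_blockPow_subdiagonal G) hβ (Pi.hasSum.2 fun k => ?_),
    isVecMul_minInv_diagonal (fun k => h.censored_nonneg k k) h.summable_censored_pow hu,
    isVecMul_minInv h.rMeasure_nonneg (isStrictlyUpper_rMeasure T G).isUpperHessenberg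
      (isStrictlyUpper_rMeasure T G).summable_blockPow hv
      (hasSum_vecStep_pow h.rMeasure_nonneg hv (h.eq_add_vecStep_rMeasure y)
        ((isStrictlyUpper_rMeasure T G).tendsto_vecStep_pow y))⟩
  simpa only [vecStep_subdiagonal_pow] using h.hasSum_ladderResidual hG1 hβ hy hlim k

end HasGMeasure

theorem le_minInv_self (hT : 0 ≤ T) (hH : IsUpperHessenberg T)
    (hs : ∀ i k, Summable fun n => blockPow T n i k) (k : ℕ) : 1 ≤ minInv T k k := by
  have hsum := hasSum_mul_minInv hT hH hs k k
  rw [Matrix.one_apply_eq] at hsum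
  exact sub_nonneg.1 <| hsum.nonneg fun j => mul_nonneg (hT k j) (minInv_nonneg hT j k)

theorem HasToeplitzRows.hasSum_mul_minInv (hA : HasToeplitzRows T A) (hT : 0 ≤ T)
    (hH : IsUpperHessenberg T) (hs : ∀ i k, Summable fun n => blockPow T n i k) (j k : ℕ) :
    HasSum (fun l => A l * minInv T (j + l) k)
      (minInv T (j + 1) k - (1 : BlockMatrix m) (j + 1) k) := by
  have hrow := MG1.hasSum_mul_minInv hT hH hs (j + 1) k
  rw [← (add_right_injective j).hasSum_iff] at hrow
  · simpa only [Function.comp_def, hA (Nat.le_add_right j _), Nat.add_sub_cancel_left] using hrow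
  · intro i hi
    have hij : ¬ j ≤ i := fun hji => hi ⟨i - j, Nat.add_sub_cancel' hji⟩
    rw [hH (by omega), zero_mul]

variable {m₀ : ℕ} {D : Blocks m₀ m}

theorem pow_mul_minInv_le (hA : HasToeplitzRows T D.A) (hT : 0 ≤ T) (hH : IsUpperHessenberg T)
    (hs : ∀ i k, Summable fun n => blockPow T n i k) (hG : D.IsMinimalSolution G) (j k l : ℕ) :
    G ^ l * minInv T j k ≤ minInv T (j + l) k :=
  Blocks.pow_mul_le (N := fun j => minInv T j k) (fun k => hA (Nat.zero_le k) ▸ hT 1 k) hG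
    (fun j => minInv_nonneg hT j k) (fun j => hA.hasSum_mul_minInv hT hH hs j k)
    (fun _ => sub_le_self _ ((matrix_one_nonneg : (0 : BlockMatrix m) ≤ 1) _ _)) l j

theorem hasGMeasure_of_summable_blockPow (hA : HasToeplitzRows T D.A) (hT : 0 ≤ T)
    (hH : IsUpperHessenberg T) (hs : ∀ i k, Summable fun n => blockPow T n i k)
    (hG : D.IsMinimalSolution G) : HasGMeasure T G := by
  have hG0 : 0 ≤ G := hG.1
  have hN := hasSum_mul_minInv hT hH hs
  have hterm : ∀ i k l, T i (k + l) * G ^ l * minInv T k k ≤ T i (k + l) * minInv T (k + l) k :=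
    fun i k l => (mul_assoc _ _ _).trans_le
      (mul_le_mul_of_nonneg_left (pow_mul_minInv_le hA hT hH hs hG k k l) (hT i (k + l)))
  have hnonneg : ∀ i k l, 0 ≤ T i (k + l) * G ^ l := fun i k l =>
    mul_nonneg (hT i (k + l)) (pow_nonneg hG0 l)
  have hsum : ∀ i k, Summable fun l => T i (k + l) * G ^ l := fun i k =>
    summable_of_nonneg_of_le (hnonneg i k)
      (fun l => (le_mul_of_one_le_right (hnonneg i k l) (le_minInv_self hT hH hs k)).trans
        (hterm i k l))
      ((hN i k).summable.comp_injective (add_right_injective k))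
  refine ⟨hT, hH, hG0, hsum, fun k => ?_, fun k => ?_⟩
  · simp only [censored, hA (Nat.le_add_right k _), Nat.add_sub_cancel_left, hG.2.1.tsum_eq]
  · refine summable_pow_of_one_add_mul_le ((hsum k k).hasSum.nonneg (hnonneg k k))
      (minInv_nonneg hT k k) ?_
    rw [← le_sub_iff_add_le']
    have hle := hasSum_le_inj (k + ·) (add_right_injective k)
      (fun j _ => mul_nonneg (hT k j) (minInv_nonneg hT j k)) (hterm k k)
      ((hsum k k).hasSum.mul_right (minInv T k k)) (hN k k)
    rwa [Matrix.one_apply_eq] at hle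

end GMeasure

/-! ### Tails -/

section Tails

variable {E : Type*} [AddCommGroup E] [TopologicalSpace E]

/-- The tails `∑_{j ≥ k} y_j` of a series. -/
def tails (y : ℕ → E) (k : ℕ) : E := ∑' j, y (k + j)

variable [IsTopologicalAddGroup E] {y : ℕ → E}

theorem hasSum_tails (hy : Summable y) (k : ℕ) : HasSum (fun j => y (k + j)) (tails y k) := by
  refine Summable.hasSum ?_
  simpa only [add_comm k] using (summable_nat_add_iff k).2 hy

theorem tails_eq_add [T2Space E] (hy : Summable y) (k : ℕ) :
    tails y k = y k + tails y (k + 1) := by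
  have h := (hasSum_nat_add_iff' 1).2 (hasSum_tails hy k)
  rw [Finset.sum_range_one, add_zero] at h
  have hnext := hasSum_tails hy (k + 1)
  simp only [add_assoc, add_comm 1] at hnext
  rw [hnext.unique h, add_sub_cancel]

theorem tendsto_tails [T2Space E] (y : ℕ → E) : Tendsto (tails y) atTop (𝓝 0) :=
  (tendsto_sum_nat_add y).congr fun k => by simp only [tails, add_comm]

theorem le_tails [PartialOrder E] [IsOrderedAddMonoid E] [OrderClosedTopology E] (hy : Summable y)
    (hy0 : 0 ≤ y) {k n : ℕ} (hkn : k ≤ n) : y n ≤ tails y k := by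
  have hle := le_hasSum (hasSum_tails hy k) (n - k) fun j _ => hy0 (k + j)
  rwa [Nat.add_sub_cancel' hkn] at hle

end Tails

theorem tails_nonneg {E : Type*} [AddCommGroup E] [PartialOrder E] [IsOrderedAddMonoid E]
    [TopologicalSpace E] [OrderClosedTopology E] {y : ℕ → E} (hy : 0 ≤ y) : 0 ≤ tails y := fun k =>
  tsum_nonneg fun j => hy (k + j)

theorem tendsto_tails_of_le {p : Type*} {f : ℕ → ℕ → p → ℝ} {y : ℕ → p → ℝ} (hy : Summable y)
    (hf : ∀ n, 0 ≤ f n) (hfy : ∀ n, f n ≤ y) (hlim : Tendsto f atTop (𝓝 0)) :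
    Tendsto (fun n => tails (f n)) atTop (𝓝 0) := by
  refine tendsto_pi_nhds.2 fun k => tendsto_pi_nhds.2 fun b => ?_
  have key := tendsto_tsum_of_dominated_convergence
    (Pi.hasSum.1 (hasSum_tails hy k) b).summable
    (fun j => tendsto_pi_nhds.1 (tendsto_pi_nhds.1 hlim (k + j)) b)
    (Eventually.of_forall fun n j => (Real.norm_of_nonneg (hf n (k + j) b)).trans_le
      (hfy n (k + j) b))
  simp only [Pi.zero_apply, tsum_zero] at key
  refine key.congr fun n => ?_
  have hs : Summable (f n) := Pi.summable.2 fun b =>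
    Summable.of_nonneg_of_le (fun j => hf n j b) (fun j => hfy n j b) (Pi.summable.1 hy b)
  exact (Pi.hasSum.1 (hasSum_tails hs k) b).tsum_eq

/-! ### The chain of M/G/1 type -/

namespace Blocks

variable {m₀ m : ℕ} {D : Blocks m₀ m} {x : State m₀ m → ℝ}

/-- The transitions among the levels `≥ 1`; row and column `n` belong to level `n + 1`. -/
def taboo (D : Blocks m₀ m) : BlockMatrix m := fun i j =>
  if i ≤ j + 1 then D.A (j + 1 - i) else 0

theorem transition_inr_inr (i j : ℕ) (a b : Fin m) :
    D.transition (Sum.inr (i, a)) (Sum.inr (j, b)) = D.taboo i j a b := by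
  rw [taboo]
  cases i <;> simp only [transition] <;> split_ifs <;> rfl

theorem A_nonneg (h : IsStochastic D.transition) : 0 ≤ D.A := fun k a b => by
  simpa [transition_inr_inr, taboo] using h.1 (Sum.inr (1, a)) (Sum.inr (k, b))

theorem B_nonneg (h : IsStochastic D.transition) : 0 ≤ fun k => D.B (k + 2) := fun k a b =>
  h.1 (Sum.inl a) (Sum.inr (k, b))

theorem taboo_nonneg (h : IsStochastic D.transition) : 0 ≤ D.taboo := fun i j a b =>
  transition_inr_inr (D := D) i j a b ▸ h.1 _ _

theorem isUpperHessenberg_taboo (D : Blocks m₀ m) : IsUpperHessenberg D.taboo :=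
  fun _ _ hij => if_neg hij.not_ge

theorem injective_inr_mk (b : Fin m) :
    Function.Injective fun k : ℕ => (Sum.inr (k, b) : State m₀ m) :=
  Sum.inr_injective.comp (Prod.mk_left_injective b)

theorem summable_A (h : IsStochastic D.transition) : Summable D.A :=
  matrix_summable_iff.2 fun a b => by
    simpa [Function.comp_def, transition_inr_inr, taboo] using
      (h.2 (Sum.inr (1, a))).summable.comp_injective (injective_inr_mk b)

theorem summable_B (h : IsStochastic D.transition) : Summable fun k => D.B (k + 2) :=
  matrix_summable_iff.2 fun a b =>
    (h.2 (Sum.inl a)).summable.comp_injective (injective_inr_mk b)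

theorem hasSum_taboo_row (h : IsStochastic D.transition) {i : ℕ} {a : Fin m}
    (hzero : ∀ b, D.transition (Sum.inr (i, a)) (Sum.inl b) = 0) :
    HasSum (fun j => ∑ b, D.taboo i j a b) 1 := by
  have hinr : HasSum (fun p : ℕ × Fin m => D.transition (Sum.inr (i, a)) (Sum.inr p)) 1 :=
    (Sum.inr_injective.hasSum_iff fun s hs => by
      cases s with
      | inl b => exact hzero b
      | inr p => exact absurd ⟨p, rfl⟩ hs).2 (h.2 (Sum.inr (i, a)))
  simp only [← transition_inr_inr]
  exact hinr.prod_fiberwise fun j => hasSum_fintype _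

theorem hasSum_A_row (h : IsStochastic D.transition) (a : Fin m) :
    HasSum (fun k => ∑ b, D.A k a b) 1 := by
  simpa [taboo] using hasSum_taboo_row h (i := 1) (a := a) fun b => rfl

theorem hasSum_A_mul_ones (h : IsStochastic D.transition) :
    HasSum (fun k => D.A k * ones (Fin m) (Fin m)) (ones _ _) :=
  Pi.hasSum.2 fun a => Pi.hasSum.2 fun b => by
    simpa [ones, Matrix.mul_apply] using hasSum_A_row h a

theorem A_zero_eq_zero [IsEmpty (Fin m₀)] (h : IsStochastic D.transition) : D.A 0 = 0 := by
  ext a b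
  have hlow : HasSum (fun k => ∑ b, D.A (k + 1) a b) 1 := by
    simpa [taboo] using hasSum_taboo_row h (i := 0) (a := a) fun b => isEmptyElim b
  have htail := (hasSum_nat_add_iff' 1).2 (hasSum_A_row h a)
  rw [Finset.sum_range_one] at htail
  have hsum : ∑ b, D.A 0 a b = 0 := by linarith [hlow.unique htail]
  exact (Finset.sum_eq_zero_iff_of_nonneg fun b _ => A_nonneg h 0 a b).1 hsum b (Finset.mem_univ b)

theorem nonempty_levelZero (h : IsStochastic D.transition) (hirr : D.transition.IsIrreducible)
    (a : Fin m) : Nonempty (Fin m₀) := by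
  by_contra hempty
  rw [not_nonempty_iff] at hempty
  have hup := forall_of_isIrreducible hirr (fun s => ∃ i c, s = Sum.inr (i + 1, c)) ?_
    (i := Sum.inr (1, a)) ⟨0, a, rfl⟩ (Sum.inr (0, a))
  · simp at hup
  · rintro _ (b | ⟨_ | j, c⟩) ⟨i, d, rfl⟩ hst
    · exact isEmptyElim b
    · refine absurd hst ?_
      rw [transition_inr_inr, taboo]
      split_ifs with hi
      · simp [show 0 + 1 - (i + 1) = 0 by omega, A_zero_eq_zero h]
      · exact lt_irrefl _
    · exact ⟨j, c, rfl⟩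

/-- The vector `(x₀ B₂, x₀ B₃, …)` of the probability flow from level `0` into the levels `≥ 1`. -/
def entrance (D : Blocks m₀ m) (x : State m₀ m → ℝ) (k : ℕ) : Fin m → ℝ :=
  levelZero x ᵥ* D.B (k + 2)

theorem hasSum_mul_transition_inr (w : State m₀ m → ℝ) (j : ℕ) (c : Fin m) :
    HasSum (fun s => w s * D.transition s (Sum.inr (j, c)))
      ((D.entrance w j + vecStep D.taboo (levelSucc w) j) c) := by
  have hfinite : (D.entrance w j + vecStep D.taboo (levelSucc w) j) c =
      ∑ s ∈ (Finset.univ : Finset (Fin m₀)).disjSum (Finset.range (j + 2) ×ˢ Finset.univ),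
        w s * D.transition s (Sum.inr (j, c)) := by
    simp only [Finset.sum_disjSum, Finset.sum_product, Pi.add_apply, vecStep_apply,
      Finset.sum_apply, transition_inr_inr]
    rfl
  rw [hfinite]
  refine hasSum_sum_of_ne_finset_zero fun s hs => ?_
  rcases s with a | ⟨i, a⟩
  · simp at hs
  · rw [transition_inr_inr, isUpperHessenberg_taboo D (show j + 2 ≤ i by simpa using hs)]
    exact mul_zero _

theorem levelSucc_eq (hx : IsStationary D.transition x) :
    levelSucc x = D.entrance x + vecStep D.taboo (levelSucc x) := by
  funext k c
  exact (hx.2.2 _).unique (hasSum_mul_transition_inr x k c)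

theorem levelZero_nonneg {w : State m₀ m → ℝ} (hw : ∀ s, 0 ≤ w s) : 0 ≤ levelZero w :=
  fun _ => hw _

theorem levelSucc_nonneg {w : State m₀ m → ℝ} (hw : ∀ s, 0 ≤ w s) : 0 ≤ levelSucc w :=
  fun _ _ => hw _

theorem entrance_nonneg (h : IsStochastic D.transition) {w : State m₀ m → ℝ} (hw : ∀ s, 0 ≤ w s) :
    0 ≤ D.entrance w := fun k => vecMul_nonneg (levelZero_nonneg hw) (B_nonneg h k)

theorem summable_entrance (h : IsStochastic D.transition) (w : State m₀ m → ℝ) :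
    Summable (D.entrance w) :=
  (hasSum_vecMul_left (levelZero w) (summable_B h).hasSum).summable

theorem summable_levelSucc {w : State m₀ m → ℝ} (hw : Summable w) : Summable (levelSucc w) :=
  Pi.summable.2 fun b => hw.comp_injective (injective_inr_mk b)

theorem eq_zero_of_vecStep_taboo_eq (h : IsStochastic D.transition)
    (hirr : D.transition.IsIrreducible) {z : ℕ → Fin m → ℝ} (hz : 0 ≤ z) (hs : Summable z)
    (hinv : vecStep D.taboo z = z) : z = 0 := by
  rcases isEmpty_or_nonempty (Fin m) with hm | ⟨⟨a⟩⟩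
  · exact Subsingleton.elim _ _
  obtain ⟨a₀⟩ := nonempty_levelZero h hirr a
  let w : State m₀ m → ℝ := Sum.elim 0 fun p => z p.1 p.2
  have hw : ∀ s, 0 ≤ w s := Sum.forall.2 ⟨fun _ => le_rfl, fun p => hz p.1 p.2⟩
  have hws : Summable w := by
    have hfiber : Summable fun p : ℕ × Fin m => z p.1 p.2 :=
      (summable_prod_of_nonneg fun p => hz p.1 p.2).2 ⟨fun _ => Summable.of_finite, by
        simpa only [tsum_fintype] using summable_sum fun b _ => Pi.summable.1 hs b⟩
    have hzero : HasSum (w ∘ Sum.inl) 0 := hasSum_zero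
    exact (HasSum.sum hzero hfiber.hasSum).summable
  have hcol : ∀ t, Summable fun s => w s * D.transition s t := fun t =>
    Summable.of_nonneg_of_le (fun s => mul_nonneg (hw s) (h.1 s t))
      (fun s => mul_le_of_le_one_right (hw s) (le_hasSum (h.2 s) t fun u _ => h.1 s u)) hws
  have hle : ∀ t, w t ≤ ∑' s, w s * D.transition s t := by
    rintro (b | ⟨i, b⟩)
    · exact tsum_nonneg fun s => mul_nonneg (hw s) (h.1 s _)
    · rw [(hasSum_mul_transition_inr w i b).tsum_eq]
      have hlevel : levelSucc w = z := rfl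
      rw [hlevel, hinv]
      exact le_add_of_nonneg_left (entrance_nonneg h hw i b)
  have hw0 := eq_zero_of_le_of_apply_eq_zero h hirr hw hws (fun t => (hcol t).hasSum) hle
    (s := Sum.inl a₀) rfl
  funext i b
  exact congrFun hw0 (Sum.inr (i, b))

theorem tendsto_vecStep_taboo_pow (h : IsStochastic D.transition)
    (hirr : D.transition.IsIrreducible) (hx : IsStationary D.transition x) :
    Tendsto (fun n => (vecStep D.taboo ^ n) (levelSucc x)) atTop (𝓝 0) := by
  obtain ⟨z, hz, hzle, hinv, hlim⟩ := exists_tendsto_vecStep_pow (taboo_nonneg h)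
    (entrance_nonneg h hx.1) (levelSucc_nonneg hx.1) (levelSucc_eq hx)
  rwa [eq_zero_of_vecStep_taboo_eq h hirr hz
    (summable_of_nonneg_of_le hz hzle (summable_levelSucc hx.2.1.summable)) hinv] at hlim

end Blocks

/-! ### The chain of the tails -/

namespace Blocks

variable {m₀ m : ℕ} {D : Blocks m₀ m} {x : State m₀ m → ℝ}

theorem taboo_eq_tailMatrix (D : Blocks m₀ m) :
    D.taboo = fun i k => D.tailMatrix (i + 1) (k + 1) := by
  funext i k
  simp only [taboo, tailMatrix, Nat.add_eq_zero_iff, one_ne_zero, and_false, if_false,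
    add_le_add_iff_right, Nat.add_sub_add_right]

theorem ATail_nonneg (h : IsStochastic D.transition) : 0 ≤ D.ATail := tails_nonneg (A_nonneg h)

theorem tailMatrix_nonneg (h : IsStochastic D.transition) : 0 ≤ D.tailMatrix := fun i j => by
  rw [tailMatrix]
  split_ifs
  exacts [ATail_nonneg h _, A_nonneg h _, le_rfl]

theorem isUpperHessenberg_tailMatrix (D : Blocks m₀ m) : IsUpperHessenberg D.tailMatrix :=
  fun i j hij => by rw [tailMatrix, if_neg (by omega), if_neg (by omega)]

theorem hasToeplitzRows_tailMatrix (D : Blocks m₀ m) : HasToeplitzRows D.tailMatrix D.A :=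
  fun i j hij => by
    rw [tailMatrix, if_neg (by omega), if_pos (by omega), Nat.add_sub_add_right]

theorem hasToeplitzRows_taboo (D : Blocks m₀ m) : HasToeplitzRows D.taboo D.A :=
  fun i j hij => by rw [taboo, if_pos (by omega), Nat.add_sub_add_right]

theorem tendsto_tailMatrix_zero (D : Blocks m₀ m) :
    Tendsto (D.tailMatrix 0) atTop (𝓝 0) :=
  (tendsto_tails D.A).comp (tendsto_add_atTop_nat 1)

theorem vecStep_taboo_eq_sub (h : IsStochastic D.transition) {y : ℕ → Fin m → ℝ}
    (hy : Summable y) (k : ℕ) : vecStep D.taboo y k =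
      vecStep D.tailMatrix (tails y) k - vecStep D.tailMatrix (tails y) (k + 1) := by
  have hdiff : ∀ i, y i = tails y i - tails y (i + 1) := fun i => by
    rw [tails_eq_add hy i, add_sub_cancel_right]
  have htaboo : vecStep D.taboo y k = ∑ i ∈ Finset.range (k + 2), y i ᵥ* D.A (k + 1 - i) := by
    rw [vecStep_apply]
    refine Finset.sum_congr rfl fun i hi => ?_
    rw [taboo, if_pos (Finset.mem_range_succ_iff.1 hi)]
  have hrow : D.tailMatrix 0 k = D.A (k + 1) + D.tailMatrix 0 (k + 1) :=
    tails_eq_add (summable_A h) (k + 1)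
  rw [htaboo, (hasToeplitzRows_tailMatrix D).vecStep_eq, (hasToeplitzRows_tailMatrix D).vecStep_eq,
    hrow, Matrix.vecMul_add]
  simp only [hdiff, Matrix.sub_vecMul, Finset.sum_sub_distrib]
  rw [Finset.sum_range_succ' (fun i => tails y i ᵥ* D.A (k + 1 - i))]
  simp only [Nat.add_sub_add_right, Nat.sub_zero]
  abel

theorem hasSum_vecStep_taboo (h : IsStochastic D.transition) {y : ℕ → Fin m → ℝ} (hy0 : 0 ≤ y)
    (hy : Summable y) (k : ℕ) :
    HasSum (fun j => vecStep D.taboo y (k + j)) (vecStep D.tailMatrix (tails y) k) := by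
  refine hasSum_of_nonneg_of_tendsto_sum_range
    (fun j => vecStep_nonneg (taboo_nonneg h) hy0 (k + j)) ?_
  have hlim := (hasToeplitzRows_tailMatrix D).tendsto_vecStep (summable_A h)
    (tendsto_tailMatrix_zero D) (tendsto_tails y)
  have hshift := (hlim.comp (tendsto_add_atTop_nat k)).const_sub (vecStep D.tailMatrix (tails y) k)
  rw [sub_zero] at hshift
  refine hshift.congr fun n => ?_
  simp only [vecStep_taboo_eq_sub h hy]
  rw [Function.comp_apply, add_comm n k]
  exact (Finset.sum_range_sub' (fun j => vecStep D.tailMatrix (tails y) (k + j)) n).symm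

theorem summable_vecStep_taboo (h : IsStochastic D.transition) {y : ℕ → Fin m → ℝ} (hy0 : 0 ≤ y)
    (hy : Summable y) : Summable (vecStep D.taboo y) := by
  simpa only [zero_add] using (hasSum_vecStep_taboo h hy0 hy 0).summable

theorem tails_vecStep_taboo (h : IsStochastic D.transition) {y : ℕ → Fin m → ℝ} (hy0 : 0 ≤ y)
    (hy : Summable y) : tails (vecStep D.taboo y) = vecStep D.tailMatrix (tails y) :=
  funext fun k => (hasSum_vecStep_taboo h hy0 hy k).tsum_eq

theorem summable_and_tails_vecStep_taboo_pow (h : IsStochastic D.transition) {y : ℕ → Fin m → ℝ}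
    (hy0 : 0 ≤ y) (hy : Summable y) (n : ℕ) : Summable ((vecStep D.taboo ^ n) y) ∧
      tails ((vecStep D.taboo ^ n) y) = (vecStep D.tailMatrix ^ n) (tails y) := by
  induction n with
  | zero => exact ⟨hy, rfl⟩
  | succ n ih =>
    have hn := vecStep_pow_nonneg (taboo_nonneg h) hy0 n
    simp only [vecStep_pow_succ_apply, ← ih.2]
    exact ⟨summable_vecStep_taboo h hn ih.1, tails_vecStep_taboo h hn ih.1⟩

theorem boundary_eq_tails (h : IsStochastic D.transition) (w : State m₀ m → ℝ) :
    D.boundary w = tails (D.entrance w) := by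
  funext k
  have hB := hasSum_vecMul_left (levelZero w) (hasSum_tails (summable_B h) k)
  have htails : ∑' j, D.B (k + 2 + j) = tails (fun k => D.B (k + 2)) k := by
    simp only [tails, add_right_comm k 2]
  rw [boundary, htails]
  exact hB.tsum_eq.symm

theorem boundary_nonneg (h : IsStochastic D.transition) {w : State m₀ m → ℝ} (hw : ∀ s, 0 ≤ w s) :
    0 ≤ D.boundary w :=
  boundary_eq_tails h w ▸ tails_nonneg (entrance_nonneg h hw)

theorem tail_eq (h : IsStochastic D.transition) (hx : IsStationary D.transition x) :
    tail x = D.boundary x + vecStep D.tailMatrix (tail x) := by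
  have hy := summable_levelSucc hx.2.1.summable
  funext k
  rw [boundary_eq_tails h]
  have hsum := (hasSum_tails (summable_entrance h x) k).add
    (hasSum_vecStep_taboo h (levelSucc_nonneg hx.1) hy k)
  have hlevel : ∀ j, D.entrance x (k + j) + vecStep D.taboo (levelSucc x) (k + j) =
      levelSucc x (k + j) := fun j => (congrFun (levelSucc_eq hx) (k + j)).symm
  simp only [hlevel] at hsum
  exact (hasSum_tails hy k).unique hsum

theorem tail_nonneg {w : State m₀ m → ℝ} (hw : ∀ s, 0 ≤ w s) : 0 ≤ tail w :=
  tails_nonneg (levelSucc_nonneg hw)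

theorem tendsto_vecStep_tailMatrix_pow (h : IsStochastic D.transition)
    (hirr : D.transition.IsIrreducible) (hx : IsStationary D.transition x) :
    Tendsto (fun n => (vecStep D.tailMatrix ^ n) (tail x)) atTop (𝓝 0) := by
  have hy0 := levelSucc_nonneg hx.1
  have hy := summable_levelSucc hx.2.1.summable
  exact (tendsto_tails_of_le hy (vecStep_pow_nonneg (taboo_nonneg h) hy0)
    (vecStep_pow_le (taboo_nonneg h) (entrance_nonneg h hx.1) (levelSucc_eq hx))
    (tendsto_vecStep_taboo_pow h hirr hx)).congr fun n =>
      (summable_and_tails_vecStep_taboo_pow h hy0 hy n).2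

theorem boundary_pos (h : IsStochastic D.transition) (hirr : D.transition.IsIrreducible)
    (hx : IsStationary D.transition x) {n j : ℕ} (hj : j ≤ n) {a : Fin m₀} {c : Fin m}
    (hB : 0 < D.B (n + 2) a c) : 0 < D.boundary x j c :=
  calc 0 < x (Sum.inl a) * D.B (n + 2) a c := mul_pos (stationary_pos h hirr hx _) hB
    _ ≤ D.entrance x n c := mul_le_vecMul (levelZero_nonneg hx.1) (B_nonneg h n) a c
    _ ≤ D.boundary x j c := boundary_eq_tails h x ▸
      le_tails (summable_entrance h x) (entrance_nonneg h hx.1) hj c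

theorem exists_tailMatrix_pos (h : IsStochastic D.transition) {l n j : ℕ} (hj : j ≤ n)
    {d c : Fin m} (hpos : 0 < D.taboo l n d c) : ∃ k ≤ l, 0 < D.tailMatrix k j d c := by
  by_cases hl : l ≤ n + 1
  · rw [taboo, if_pos hl] at hpos
    by_cases hjn : j + l ≤ n
    · exact ⟨0, Nat.zero_le l, hpos.trans_le <|
        le_tails (summable_A h) (A_nonneg h) (show j + 1 ≤ n + 1 - l by omega) d c⟩
    · obtain ⟨i, hi⟩ : ∃ i, j + l - n = i + 1 := ⟨j + l - n - 1, by omega⟩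
      refine ⟨i + 1, by omega, ?_⟩
      rwa [hasToeplitzRows_tailMatrix D (by omega), show j - i = n + 1 - l by omega]
  · rw [taboo, if_neg hl] at hpos
    exact absurd hpos (lt_irrefl _)

theorem exists_vecStep_tailMatrix_pow_pos (h : IsStochastic D.transition)
    (hirr : D.transition.IsIrreducible) (hx : IsStationary D.transition x) (i : ℕ) (a : Fin m) :
    ∃ n, 0 < (vecStep D.tailMatrix ^ n) (D.boundary x) i a := by
  obtain ⟨a₀⟩ := nonempty_levelZero h hirr a
  -- A jump of the chain up to level `n` feeds the tails at all levels `j ≤ n`.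
  refine forall_of_isIrreducible hirr (fun s => ∀ n c, s = Sum.inr (n, c) → ∀ j ≤ n,
    ∃ N, 0 < (vecStep D.tailMatrix ^ N) (D.boundary x) j c) ?_ (i := Sum.inl a₀) (by simp)
    (Sum.inr (i, a)) i a rfl i le_rfl
  rintro (b | ⟨l, d⟩) _ hreach hst n c rfl j hj
  · exact ⟨0, boundary_pos h hirr hx hj hst⟩
  · rw [transition_inr_inr] at hst
    obtain ⟨k, hkl, hk⟩ := exists_tailMatrix_pos h hj hst
    obtain ⟨N, hN⟩ := hreach l d rfl k hkl
    refine ⟨N + 1, (mul_pos hN hk).trans_le ?_⟩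
    rw [vecStep_pow_succ_apply]
    exact mul_le_vecStep (tailMatrix_nonneg h) (isUpperHessenberg_tailMatrix D)
      (vecStep_pow_nonneg (tailMatrix_nonneg h) (boundary_nonneg h hx.1) N) k j d c

theorem summable_blockPow_tailMatrix (h : IsStochastic D.transition)
    (hirr : D.transition.IsIrreducible) (hx : IsStationary D.transition x) (i k : ℕ) :
    Summable fun n => blockPow D.tailMatrix n i k :=
  summable_blockPow_of_reachable (tailMatrix_nonneg h) (isUpperHessenberg_tailMatrix D)
    (boundary_nonneg h hx.1) (tail_nonneg hx.1) (tail_eq h hx)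
    (exists_vecStep_tailMatrix_pow_pos h hirr hx) i k

theorem isVecMul_minInv_tailMatrix (h : IsStochastic D.transition)
    (hirr : D.transition.IsIrreducible) (hx : IsStationary D.transition x) :
    IsVecMul (D.boundary x) (minInv D.tailMatrix) (tail x) :=
  isVecMul_minInv (tailMatrix_nonneg h) (isUpperHessenberg_tailMatrix D)
    (summable_blockPow_tailMatrix h hirr hx) (boundary_nonneg h hx.1)
    (hasSum_vecStep_pow (tailMatrix_nonneg h) (boundary_nonneg h hx.1) (tail_eq h hx)
      (tendsto_vecStep_tailMatrix_pow h hirr hx))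

variable {G : Matrix (Fin m) (Fin m) ℝ}

theorem hasGMeasure_tailMatrix (h : IsStochastic D.transition) (hirr : D.transition.IsIrreducible)
    (hx : IsStationary D.transition x) (hG : D.IsMinimalSolution G) :
    HasGMeasure D.tailMatrix G :=
  hasGMeasure_of_summable_blockPow (hasToeplitzRows_tailMatrix D) (tailMatrix_nonneg h)
    (isUpperHessenberg_tailMatrix D) (summable_blockPow_tailMatrix h hirr hx) hG

theorem hasGMeasure_taboo (hG : HasGMeasure D.tailMatrix G) : HasGMeasure D.taboo G :=
  taboo_eq_tailMatrix D ▸ hG.shift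

theorem g_pow_le_ones (h : IsStochastic D.transition) (hG : D.IsMinimalSolution G) (k : ℕ) :
    G ^ k ≤ ones _ _ :=
  pow_le_ones (A_nonneg h) (hasSum_A_mul_ones h) hG k

end Blocks

/-! ### The `RG`-factorization in terms of the blocks -/

section GeomTails

variable {m : ℕ} {p : Type*} {T : BlockMatrix m} {A : ℕ → Matrix (Fin m) (Fin m) ℝ}
  {G : Matrix (Fin m) (Fin m) ℝ}

/-- The series `∑_{n ≥ 0} C_{k+n} Gⁿ`, of which `Ψ` and the `R`-measures are made. -/
def geomTails (C : ℕ → Matrix p (Fin m) ℝ) (G : Matrix (Fin m) (Fin m) ℝ) (k : ℕ) :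
    Matrix p (Fin m) ℝ :=
  ∑' n, C (k + n) * G ^ n

theorem HasToeplitzRows.censored (hT : HasToeplitzRows T A) (G : Matrix (Fin m) (Fin m) ℝ) :
    HasToeplitzRows (censored T G) (geomTails A G) := fun i k hik => by
  simp only [MG1.censored, geomTails, hT (hik.trans (Nat.le_add_right k _)),
    Nat.sub_add_comm hik]

theorem HasToeplitzRows.hasSum_geomTails (hT : HasToeplitzRows T A) (hG : HasGMeasure T G)
    (k : ℕ) : HasSum (fun n => A (k + n) * G ^ n) (geomTails A G k) := by
  have hsum := hG.summable 1 k
  simp only [hT (Nat.zero_le _), Nat.sub_zero] at hsum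
  exact hsum.hasSum

end GeomTails

namespace Blocks

variable {m₀ m : ℕ} {D : Blocks m₀ m} {G : Matrix (Fin m) (Fin m) ℝ}

theorem Psi_eq_geomTails (D : Blocks m₀ m) (G : Matrix (Fin m) (Fin m) ℝ) :
    D.Psi G = geomTails D.A G 1 := by
  simp only [Psi, geomTails, add_comm 1]

theorem censored_taboo (G : Matrix (Fin m) (Fin m) ℝ) {i k : ℕ} (hik : i ≤ k) :
    censored D.taboo G i k = geomTails D.A G (k - i + 1) := by
  have htaboo : ∀ l, D.taboo i (k + l) = D.A (k - i + 1 + l) := fun l => by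
    rw [taboo, if_pos (by omega), show k + l + 1 - i = k - i + 1 + l by omega]
  simp only [censored, geomTails, htaboo]

theorem censored_taboo_self (D : Blocks m₀ m) (G : Matrix (Fin m) (Fin m) ℝ) (k : ℕ) :
    censored D.taboo G k k = D.Psi G := by
  rw [censored_taboo G le_rfl, Nat.sub_self, zero_add, Psi_eq_geomTails]

theorem tailMatrix_zero_add (D : Blocks m₀ m) (k l : ℕ) :
    D.tailMatrix 0 (k + l) = D.ATail (k + 1 + l) := by
  rw [tailMatrix, if_pos rfl, add_right_comm]

theorem censored_tailMatrix_zero (D : Blocks m₀ m) (G : Matrix (Fin m) (Fin m) ℝ) (k : ℕ) :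
    censored D.tailMatrix G 0 k = geomTails D.ATail G (k + 1) := by
  simp only [censored, geomTails, tailMatrix_zero_add]

theorem censored_tailMatrix_succ_self (D : Blocks m₀ m) (G : Matrix (Fin m) (Fin m) ℝ) (k : ℕ) :
    censored D.tailMatrix G (k + 1) (k + 1) = D.Psi G := by
  rw [(hasToeplitzRows_tailMatrix D).censored G (Nat.le_add_right k 1), Nat.add_sub_cancel_left,
    Psi_eq_geomTails]

theorem hasSum_geomTails_A (h : IsStochastic D.transition) (hG : HasGMeasure D.tailMatrix G)
    (k : ℕ) : HasSum (fun j => geomTails D.A G (k + 1 + j)) (geomTails D.ATail G (k + 1)) := by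
  have hrow : ∀ l, HasSum (fun j => D.A (k + 1 + l + j) * G ^ l) (D.ATail (k + 1 + l) * G ^ l) :=
    fun l => (hasSum_tails (summable_A h) (k + 1 + l)).mul_right (G ^ l)
  have hcol : ∀ j, HasSum (fun l => D.A (k + 1 + l + j) * G ^ l) (geomTails D.A G (k + 1 + j)) :=
    fun j => by
      simpa only [add_right_comm _ j] using
        (hasToeplitzRows_tailMatrix D).hasSum_geomTails hG (k + 1 + j)
  have hsum := hG.hasSum_censored 0 k
  simp only [tailMatrix_zero_add, censored_tailMatrix_zero] at hsum
  exact hasSum_comm_of_nonneg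
    (fun l j => mul_nonneg (A_nonneg h _) (pow_nonneg hG.g_nonneg l)) hrow hcol hsum

theorem summable_geomTails_A (h : IsStochastic D.transition) (hG : HasGMeasure D.tailMatrix G) :
    Summable (geomTails D.A G) :=
  (summable_nat_add_iff 1).1 <| by
    simpa only [zero_add, add_comm 1] using (hasSum_geomTails_A h hG 0).summable

theorem tendsto_censored_taboo_zero (h : IsStochastic D.transition)
    (hG : HasGMeasure D.tailMatrix G) : Tendsto (censored D.taboo G 0) atTop (𝓝 0) :=
  ((summable_geomTails_A h hG).tendsto_atTop_zero.comp (tendsto_add_atTop_nat 1)).congr fun k =>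
    (censored_taboo G (Nat.zero_le k)).symm

theorem tendsto_censored_tailMatrix_zero (h : IsStochastic D.transition)
    (hG : HasGMeasure D.tailMatrix G) : Tendsto (censored D.tailMatrix G 0) atTop (𝓝 0) :=
  ((tendsto_tails (geomTails D.A G)).comp (tendsto_add_atTop_nat 1)).congr fun k => by
    rw [censored_tailMatrix_zero]
    exact (hasSum_geomTails_A h hG k).tsum_eq

theorem summable_Psi_pow (hG : HasGMeasure D.tailMatrix G) : Summable fun n => D.Psi G ^ n := by
  simpa only [censored_tailMatrix_succ_self] using hG.summable_censored_pow 1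

theorem G1_eq (hG : HasGMeasure D.tailMatrix G) : D.G1 G = G := by
  have hA := (hasGMeasure_taboo hG).censored_eq_add 1 0
  have htaboo : D.taboo 1 0 = D.A 0 := rfl
  rw [(hasGMeasure_taboo hG).censored_succ, zero_add, censored_taboo_self, htaboo,
    ← sub_eq_iff_eq_add, ← one_sub_mul] at hA
  have hunit := isUnit_one_sub_of_summable_pow (summable_Psi_pow hG)
  rw [G1, ← hA, Matrix.nonsing_inv_mul_cancel_left _ _ ((Matrix.isUnit_iff_isUnit_det _).1 hunit)]

theorem hasSum_ATail_mul_G1 (hG : HasGMeasure D.tailMatrix G) :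
    HasSum (fun k => D.ATail (k + 2) * G ^ k * D.G1 G) (censored D.tailMatrix G 0 1 * G) := by
  have hsum := (hG.hasSum_censored 0 1).mul_right G
  simpa only [tailMatrix_zero_add, G1_eq hG, one_add_one_eq_two, add_comm 2] using hsum

theorem PsiHat0_eq_censored (hG : HasGMeasure D.tailMatrix G) :
    D.PsiHat0 G = censored D.tailMatrix G 0 0 := by
  rw [hG.censored_eq_add, PsiHat0, (hasSum_ATail_mul_G1 hG).tsum_eq]
  rfl

theorem lowerG_eq_subdiagonal (hG : HasGMeasure D.tailMatrix G) : D.lowerG G = subdiagonal G := by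
  funext i j
  simp only [lowerG, subdiagonal, G1_eq hG, ite_self]

theorem PsiD_eq_diagonal (hG : HasGMeasure D.tailMatrix G) :
    D.PsiD G = Matrix.diagonal fun k => censored D.tailMatrix G k k := by
  rw [PsiD]
  congr 1
  funext k
  cases k with
  | zero => exact PsiHat0_eq_censored hG
  | succ k => exact (censored_tailMatrix_succ_self D G k).symm

theorem RU_eq_rMeasure (D : Blocks m₀ m) (G : Matrix (Fin m) (Fin m) ℝ) :
    D.RU G = rMeasure D.tailMatrix G := by
  funext i j
  rw [RU, rMeasure]
  split_ifs with hij hi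
  · obtain ⟨j, rfl⟩ := Nat.exists_eq_add_of_lt hij
    subst hi
    rw [zero_add, censored_tailMatrix_zero, censored_tailMatrix_succ_self]
    rfl
  · obtain ⟨i, rfl⟩ := Nat.exists_eq_succ_of_ne_zero hi
    obtain ⟨k, rfl⟩ := Nat.exists_eq_add_of_lt hij
    rw [(hasToeplitzRows_tailMatrix D).censored G (by omega), censored_tailMatrix_succ_self, R,
      show i.succ + k + 1 - i.succ + 1 = i.succ + k + 1 - i by omega]
    rfl
  · rfl

theorem rMeasure_taboo (D : Blocks m₀ m) (G : Matrix (Fin m) (Fin m) ℝ) :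
    rMeasure D.taboo G = D.RDiff G := by
  funext i j
  rw [rMeasure, RDiff]
  split_ifs with hij
  · rw [censored_taboo G hij.le, censored_taboo_self]
    rfl
  · rfl

end Blocks

/-! ### Ramaswami's recursion and the tails -/

namespace Blocks

variable {m₀ m : ℕ} {D : Blocks m₀ m} {x : State m₀ m → ℝ} {G : Matrix (Fin m) (Fin m) ℝ}

theorem summable_B_mul_pow (h : IsStochastic D.transition) (hG : D.IsMinimalSolution G) (j : ℕ) :
    Summable fun k => D.B (j + 2 + k) * G ^ k := by
  have hB := (summable_B h).comp_injective (add_right_injective j)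
  simpa only [Function.comp_def, add_right_comm j] using
    summable_mul_of_le_ones (fun k => B_nonneg h (j + k)) hB (pow_nonneg (show 0 ≤ G from hG.1))
      (g_pow_le_ones h hG)

theorem summable_ATail_mul_pow (hG : HasGMeasure D.tailMatrix G) (j : ℕ) :
    Summable fun k => D.ATail (j + 1 + k) * G ^ k := by
  simpa only [tailMatrix_zero_add] using hG.summable 0 j

theorem inv_one_sub_Psi_nonneg (hG : HasGMeasure D.tailMatrix G) : 0 ≤ (1 - D.Psi G)⁻¹ := by
  simpa only [censored_tailMatrix_succ_self] using hG.inv_one_sub_censored_nonneg 1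

theorem R0_nonneg (h : IsStochastic D.transition) (hG : HasGMeasure D.tailMatrix G) (k : ℕ) :
    0 ≤ D.R0 G (k + 1) := by
  refine matrix_mul_nonneg (tsum_nonneg fun l => ?_) (inv_one_sub_Psi_nonneg hG)
  rw [add_assoc k, add_right_comm k]
  exact matrix_mul_nonneg (B_nonneg h (k + l)) (pow_nonneg hG.g_nonneg l)

theorem RDiff_nonneg (hG : HasGMeasure D.tailMatrix G) : 0 ≤ D.RDiff G :=
  rMeasure_taboo D G ▸ (hasGMeasure_taboo hG).rMeasure_nonneg

theorem ladderResidual_taboo_vecMul (h : IsStochastic D.transition)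
    (hx : IsStationary D.transition x) (hmin : D.IsMinimalSolution G)
    (hG : HasGMeasure D.tailMatrix G) (k : ℕ) :
    ladderResidual D.taboo G (levelSucc x) k ᵥ* (1 - D.Psi G)⁻¹ =
      levelZero x ᵥ* D.R0 G (k + 1) := by
  have hW := hasGMeasure_taboo hG
  have hlim := hW.tendsto_ladderResidual ((hasToeplitzRows_taboo D).censored G)
    (summable_geomTails_A h hG) (tendsto_censored_taboo_zero h hG)
    (summable_levelSucc hx.2.1.summable).tendsto_atTop_zero
  have hladder := hW.hasSum_ladderResidual (g_pow_le_ones h hmin) (entrance_nonneg h hx.1)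
    (levelSucc_eq hx) hlim k
  have hblocks := hasSum_vecMul_left (levelZero x) (summable_B_mul_pow h hmin k).hasSum
  simp only [entrance, Matrix.vecMul_vecMul, add_right_comm k _ 2] at hladder
  rw [hladder.unique hblocks, Matrix.vecMul_vecMul, R0, add_assoc k]

theorem levelSucc_eq_add_vecStep_rMeasure (h : IsStochastic D.transition)
    (hx : IsStationary D.transition x) (hmin : D.IsMinimalSolution G)
    (hG : HasGMeasure D.tailMatrix G) : levelSucc x =
      (fun k => levelZero x ᵥ* D.R0 G (k + 1)) + vecStep (rMeasure D.taboo G) (levelSucc x) := by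
  simpa only [censored_taboo_self, ladderResidual_taboo_vecMul h hx hmin hG] using
    (hasGMeasure_taboo hG).eq_add_vecStep_rMeasure (levelSucc x)

theorem summable_R0 (h : IsStochastic D.transition) (hirr : D.transition.IsIrreducible)
    (hx : IsStationary D.transition x) (hmin : D.IsMinimalSolution G)
    (hG : HasGMeasure D.tailMatrix G) : Summable fun k => D.R0 G (k + 1) := by
  refine matrix_summable_iff.2 fun a b => ?_
  have hpos := stationary_pos h hirr hx (Sum.inl a)
  refine Summable.of_nonneg_of_le (fun k => R0_nonneg h hG k a b) (fun k => ?_)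
    ((Pi.summable.1 (summable_levelSucc hx.2.1.summable) b).mul_left (x (Sum.inl a))⁻¹)
  rw [inv_mul_eq_div, le_div_iff₀' hpos]
  calc x (Sum.inl a) * D.R0 G (k + 1) a b ≤ (levelZero x ᵥ* D.R0 G (k + 1)) b :=
        mul_le_vecMul (levelZero_nonneg hx.1) (R0_nonneg h hG k) a b
    _ ≤ levelSucc x k b := by
        conv_rhs => rw [levelSucc_eq_add_vecStep_rMeasure h hx hmin hG]
        exact le_add_of_nonneg_right <|
          vecStep_nonneg (hasGMeasure_taboo hG).rMeasure_nonneg (levelSucc_nonneg hx.1) k b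

theorem summable_RDiff (h : IsStochastic D.transition) (hG : HasGMeasure D.tailMatrix G)
    (i : ℕ) : Summable (D.RDiff G i) := by
  rw [← summable_nat_add_iff (i + 1)]
  have hR := ((summable_nat_add_iff 2).2 (summable_geomTails_A h hG)).mul_right (1 - D.Psi G)⁻¹
  refine hR.congr fun n => ?_
  rw [RDiff, if_pos (by omega), show n + (i + 1) - i = n + 1 by omega]
  rfl

theorem isVecMul_RDiff (h : IsStochastic D.transition) (hx : IsStationary D.transition x)
    (hmin : D.IsMinimalSolution G) (hG : HasGMeasure D.tailMatrix G) :
    IsVecMul (levelSucc x) (D.RDiff G)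
      (fun k => levelSucc x k - levelZero x ᵥ* D.R0 G (k + 1)) := by
  have hstep : (fun k => levelSucc x k - levelZero x ᵥ* D.R0 G (k + 1)) =
      vecStep (rMeasure D.taboo G) (levelSucc x) :=
    sub_eq_of_eq_add' (levelSucc_eq_add_vecStep_rMeasure h hx hmin hG)
  rw [hstep, ← rMeasure_taboo]
  exact isVecMul_vecStep (isStrictlyUpper_rMeasure D.taboo G).isUpperHessenberg _

theorem RDiff_succ_succ (D : Blocks m₀ m) (G : Matrix (Fin m) (Fin m) ℝ) (i k : ℕ) :
    D.RDiff G (i + 1) (k + 1) = D.RDiff G i k := by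
  simp only [RDiff, Nat.add_lt_add_iff_right, Nat.add_sub_add_right]

theorem hasSum_levelSucc_vecMul_tails_RDiff (h : IsStochastic D.transition)
    (hirr : D.transition.IsIrreducible) (hx : IsStationary D.transition x)
    (hmin : D.IsMinimalSolution G) (hG : HasGMeasure D.tailMatrix G) (k : ℕ) :
    HasSum (fun i => levelSucc x i ᵥ* tails (D.RDiff G i) k)
      (tail x k - levelZero x ᵥ* tails (fun j => D.R0 G (j + 1)) k) :=
  hasSum_comm_of_nonneg
    (fun j i => vecMul_nonneg (levelSucc_nonneg hx.1 i) (RDiff_nonneg hG i (k + j)))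
    (fun j => isVecMul_RDiff h hx hmin hG (k + j))
    (fun i => hasSum_vecMul_left _ (hasSum_tails (summable_RDiff h hG i) k))
    ((hasSum_tails (summable_levelSucc hx.2.1.summable) k).sub
      (hasSum_vecMul_left _ (hasSum_tails (summable_R0 h hirr hx hmin hG) k)))

theorem tail_eq_add_tsum_RDiff (h : IsStochastic D.transition) (hirr : D.transition.IsIrreducible)
    (hx : IsStationary D.transition x) (hmin : D.IsMinimalSolution G)
    (hG : HasGMeasure D.tailMatrix G) (k : ℕ) :
    Summable (fun j => D.R0 G (k + 1 + j)) ∧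
      (∀ i : ℕ, Summable (fun j => D.RDiff G (i + 1) (k + 1 + j))) ∧
      Summable (fun i => levelSucc x i ᵥ* ∑' j, D.RDiff G (i + 1) (k + 1 + j)) ∧
      tail x k = levelZero x ᵥ* (∑' j, D.R0 G (k + 1 + j)) +
        ∑' i, levelSucc x i ᵥ* ∑' j, D.RDiff G (i + 1) (k + 1 + j) := by
  have hR0 := hasSum_tails (summable_R0 h hirr hx hmin hG) k
  have hRDiff := fun i => hasSum_tails (summable_RDiff h hG i) k
  have htail := hasSum_levelSucc_vecMul_tails_RDiff h hirr hx hmin hG k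
  simp only [add_right_comm k 1, RDiff_succ_succ, hR0.tsum_eq, (hRDiff _).tsum_eq, htail.tsum_eq,
    add_sub_cancel]
  exact ⟨hR0.summable, fun i => (hRDiff i).summable, htail.summable, trivial⟩

/-! ### The factors of `(I - P)⁻¹` -/

theorem hasMinInv_lowerG (hG : HasGMeasure D.tailMatrix G) : HasMinInv (D.lowerG G) :=
  lowerG_eq_subdiagonal hG ▸ hasMinInv_of_summable (subdiagonal_nonneg hG.g_nonneg)
    (isUpperHessenberg_subdiagonal G) (summable_blockPow_subdiagonal G)

theorem hasMinInv_PsiD (hG : HasGMeasure D.tailMatrix G) : HasMinInv (D.PsiD G) :=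
  PsiD_eq_diagonal hG ▸ hasMinInv_of_summable (diagonal_nonneg fun k => hG.censored_nonneg k k)
    (isUpperHessenberg_diagonal _) (summable_blockPow_diagonal hG.summable_censored_pow)

theorem hasMinInv_RU (hG : HasGMeasure D.tailMatrix G) : HasMinInv (D.RU G) :=
  RU_eq_rMeasure D G ▸ hasMinInv_of_summable hG.rMeasure_nonneg
    (isStrictlyUpper_rMeasure D.tailMatrix G).isUpperHessenberg
    (isStrictlyUpper_rMeasure D.tailMatrix G).summable_blockPow

theorem exists_isVecMul_tail (h : IsStochastic D.transition) (hx : IsStationary D.transition x)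
    (hmin : D.IsMinimalSolution G) (hG : HasGMeasure D.tailMatrix G) :
    ∃ u v : ℕ → Fin m → ℝ,
      IsVecMul (D.boundary x) (minInv (D.lowerG G)) u ∧
      IsVecMul u (minInv (D.PsiD G)) v ∧
      IsVecMul v (minInv (D.RU G)) (tail x) := by
  rw [lowerG_eq_subdiagonal hG, PsiD_eq_diagonal hG, RU_eq_rMeasure]
  exact ⟨_, _, hG.isVecMul_ladderResidual (g_pow_le_ones h hmin) (boundary_nonneg h hx.1)
    (tail_eq h hx) (hG.tendsto_ladderResidual ((hasToeplitzRows_tailMatrix D).censored G)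
      (summable_geomTails_A h hG) (tendsto_censored_tailMatrix_zero h hG)
      (tendsto_tails (levelSucc x)))⟩

end Blocks

end MG1

end

theorem mainTheorem6 {m₀ m : ℕ} (D : MG1.Blocks m₀ m)
    (hstoch : MG1.IsStochastic D.transition)
    (hirr : D.transition.IsIrreducible)
    (hrec : MG1.IsPositiveRecurrent D.transition)
    (x : MG1.State m₀ m → ℝ) (hx : MG1.IsStationary D.transition x)
    (G : Matrix (Fin m) (Fin m) ℝ) (hG : D.IsMinimalSolution G) :
    -- the series that define the tails, `Ψ` and the `R`-measure converge; `I - Ψ` is invertible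
    (Summable (MG1.levelSucc x) ∧
      Summable (fun k => D.A (k + 1) * G ^ k) ∧
      IsUnit (1 - D.Psi G) ∧
      (∀ j, Summable (fun k => D.B (j + 2 + k) * G ^ k)) ∧
      (∀ j, Summable (fun k => D.A (j + 2 + k) * G ^ k))) ∧
    -- the tails through the `R`-measure (the level index `k` of the formula is `k + 1` here)
    (∀ k : ℕ,
      Summable (fun j => D.R0 G (k + 1 + j)) ∧
      (∀ i : ℕ, Summable (fun j => D.RDiff G (i + 1) (k + 1 + j))) ∧
      Summable (fun i => MG1.levelSucc x i ᵥ* ∑' j, D.RDiff G (i + 1) (k + 1 + j)) ∧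
      MG1.tail x k = MG1.levelZero x ᵥ* (∑' j, D.R0 G (k + 1 + j)) +
        ∑' i, MG1.levelSucc x i ᵥ* ∑' j, D.RDiff G (i + 1) (k + 1 + j)) ∧
    -- the series that define the factors of the `RG`-factorization and the boundary vector
    -- converge
    (Summable D.A ∧
      Summable (fun k => D.B (k + 2)) ∧
      Summable (fun k => D.ATail (k + 2) * G ^ k * D.G1 G) ∧
      (∀ j, Summable (fun k => D.ATail (j + 2 + k) * G ^ k))) ∧
    -- the infinite matrices below have minimal inverses
    (MG1.HasMinInv D.tailMatrix ∧ MG1.HasMinInv (D.lowerG G) ∧ MG1.HasMinInv (D.PsiD G) ∧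
      MG1.HasMinInv (D.RU G)) ∧
    -- `π = b (I - P)⁻¹ = b (I - G_L)⁻¹ (I - Ψ_D)⁻¹ (I - R_U)⁻¹`, with `P` the matrix `tailMatrix`
    MG1.IsVecMul (D.boundary x) (MG1.minInv D.tailMatrix) (MG1.tail x) ∧
    ∃ u v : ℕ → Fin m → ℝ,
      MG1.IsVecMul (D.boundary x) (MG1.minInv (D.lowerG G)) u ∧
      MG1.IsVecMul u (MG1.minInv (D.PsiD G)) v ∧
      MG1.IsVecMul v (MG1.minInv (D.RU G)) (MG1.tail x) := by
  have hW := MG1.Blocks.hasGMeasure_tailMatrix hstoch hirr hx hG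
  have hA := (MG1.Blocks.hasToeplitzRows_tailMatrix D).hasSum_geomTails hW
  have hAT := MG1.Blocks.summable_ATail_mul_pow hW
  have hP := MG1.Blocks.summable_blockPow_tailMatrix hstoch hirr hx
  refine ⟨⟨MG1.Blocks.summable_levelSucc hx.2.1.summable,
      by simpa only [add_comm 1] using (hA 1).summable,
      MG1.isUnit_one_sub_of_summable_pow (MG1.Blocks.summable_Psi_pow hW),
      MG1.Blocks.summable_B_mul_pow hstoch hG, fun j => (hA (j + 2)).summable⟩,
    MG1.Blocks.tail_eq_add_tsum_RDiff hstoch hirr hx hG hW,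
    ⟨MG1.Blocks.summable_A hstoch, MG1.Blocks.summable_B hstoch,
      (MG1.Blocks.hasSum_ATail_mul_G1 hW).summable, fun j => hAT (j + 1)⟩,
    ⟨MG1.hasMinInv_of_summable (MG1.Blocks.tailMatrix_nonneg hstoch)
        (MG1.Blocks.isUpperHessenberg_tailMatrix D) hP,
      MG1.Blocks.hasMinInv_lowerG hW, MG1.Blocks.hasMinInv_PsiD hW, MG1.Blocks.hasMinInv_RU hW⟩,
    MG1.Blocks.isVecMul_minInv_tailMatrix hstoch hirr hx,
    MG1.Blocks.exists_isVecMul_tail hstoch hx hG hW⟩
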